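/- Let $P_0,P_1,\dots$ be the orthonormal Legendre polynomials on $[0,1]$ ($\deg P_j=j$, $\int_0^1P_iP_j\,dx=\delta_{ij}$), let $1\le s\le k$ be integers, and let $(c_\ell,b_\ell)_{\ell=1}^k$ be the abscissae (the zeros of $P_k$) and weights of the $k$-point Gauss–Legendre quadrature on $[0,1]$. Let $U\subseteq\mathbb R^m$ be open, let $H:U\to\mathbb R$ be of class $C^{2s+1}$, let $B:U\to\mathbb R^{m\times m}$ be of class $C^{2s}$ with $B(x)^\top=-B(x)$ for all $x\in U$, and let $y:[0,T]\to U$, $T>0$, be the solution of the Poisson problem $$\dot y=B(y)\nabla H(y),\qquad y(0)=y_0 .$$ For a time-step $h>0$, the PHBVM$(k,s)$ method computes a polynomial path $u$ of degree at most $s$ from $$u(ch)=y_0+h\sum_{i,j=0}^{s-1}\int_0^cP_i(x)\,dx\;\hat\rho_{ij}(u)\,\hat\gamma_j(u),\qquad \hat\gamma_j(u)=\sum_{\ell=1}^kb_\ell P_j(c_\ell)\nabla H(u(c_\ell h)),\qquad \hat\rho_{ij}(u)=\sum_{\ell=1}^kb_\ell P_i(c_\ell)P_j(c_\ell)B(u(c_\ell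 h)),$$ and takes $y_1:=u(h)$ as approximation of $y(h)$. Then $y_1-y(h)=O(h^{2s+1})$ as $h\to0^+$. More precisely: for every compact neighbourhood $K\subseteq U$ of $y_0$ there are $C\in\mathbb R$ and $h_0\in(0,T]$ such that for every $h\in(0,h_0]$ the above equation has exactly one solution $u$ with $u(c_\ell h)\in K$ for $\ell=1,\dots,k$, and this solution satisfies $\|u(h)-y(h)\|\le C\,h^{2s+1}$. -/

import Mathlib

namespace PHBVM

noncomputable section

/-- The orthonormal Legendre polynomial `P j` of degree `j` on `[0,1]`, with positive leading
coefficient. (Mathlib's `Polynomial.shiftedLegendre j` has squared `L²(0,1)`-norm `1 / (2 j + 1)`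
and leading coefficient of sign `(-1) ^ j`.) -/
def P (j : ℕ) : Polynomial ℝ :=
  Polynomial.C ((-1) ^ j * Real.sqrt (2 * j + 1)) *
    (Polynomial.shiftedLegendre j).map (Int.castRingHom ℝ)

/-- The abscissae of the `k`-point Gauss-Legendre quadrature on `[0,1]`: the zeros of `P k`. -/
def nodes (k : ℕ) : Finset ℝ := (P k).roots.toFinset

/-- The weight that belongs to the abscissa `c` in the interpolatory quadrature rule based at
`nodes k`, that is, the integral over `[0,1]` of the Lagrange basis polynomial of `c`. -/
def weight (k : ℕ) (c : ℝ) : ℝ := ∫ x in (0 : ℝ)..1, (Lagrange.basis (nodes k) id c).eval x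

variable {m : ℕ}

/-- The matrix-vector product `M v`, for `v` in Euclidean space. -/
def act (M : Matrix (Fin m) (Fin m) ℝ) (v : EuclideanSpace ℝ (Fin m)) :
    EuclideanSpace ℝ (Fin m) :=
  WithLp.toLp 2 (Matrix.mulVec M (WithLp.ofLp v))

/-- The discrete Fourier coefficient of `∇H` along the path `u`, with time-step `h`:
`γ̂ⱼ(u) = ∑ₗ bₗ Pⱼ(cₗ) ∇H(u(cₗ h))`. -/
def gammaHat (k : ℕ) (H : EuclideanSpace ℝ (Fin m) → ℝ) (h : ℝ)
    (u : ℝ → EuclideanSpace ℝ (Fin m)) (j : ℕ) : EuclideanSpace ℝ (Fin m) :=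
  ∑ c ∈ nodes k, (weight k c * (P j).eval c) • gradient H (u (c * h))

/-- The discrete Fourier coefficient of `B` along the path `u`, with time-step `h`:
`ρ̂ᵢⱼ(u) = ∑ₗ bₗ Pᵢ(cₗ) Pⱼ(cₗ) B(u(cₗ h))`. -/
def rhoHat (k : ℕ) (B : EuclideanSpace ℝ (Fin m) → Matrix (Fin m) (Fin m) ℝ) (h : ℝ)
    (u : ℝ → EuclideanSpace ℝ (Fin m)) (i j : ℕ) : Matrix (Fin m) (Fin m) ℝ :=
  ∑ c ∈ nodes k, (weight k c * (P i).eval c * (P j).eval c) • B (u (c * h))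

/-- `u` is a polynomial path produced by the PHBVM`(k,s)` method with time-step `h` from the
initial value `y₀`:
`u(c h) = y₀ + h ∑_{i,j<s} (∫₀ᶜ Pᵢ(x) dx) ρ̂ᵢⱼ(u) γ̂ⱼ(u)`.
Both sides are polynomials in `c`, so requiring the identity for all real `c` only extends `u`
from `[0,h]` to the real line as the same polynomial. The new approximation is `y₁ = u(h)`. -/
def IsPath (k s : ℕ) (B : EuclideanSpace ℝ (Fin m) → Matrix (Fin m) (Fin m) ℝ)
    (H : EuclideanSpace ℝ (Fin m) → ℝ) (y₀ : EuclideanSpace ℝ (Fin m)) (h : ℝ)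
    (u : ℝ → EuclideanSpace ℝ (Fin m)) : Prop :=
  ∀ c : ℝ, u (c * h) = y₀ + h • ∑ i ∈ Finset.range s, ∑ j ∈ Finset.range s,
    (∫ x in (0 : ℝ)..c, (P i).eval x) • act (rhoHat k B h u i j) (gammaHat k H h u j)

end

end PHBVM

/-!
The differential equation is treated in the form `y' = A(y) g(y)`, where `A` takes values in the
linear maps and `g` in the vectors, both `2 s` times continuously differentiable.

*The method as a projection.* Let `quad k` be the Gauss-Legendre rule and `proj k s` the orthogonal
projection onto the polynomials of degree less than `s`, with respect to the discrete inner product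
given by `quad k`. On the unit interval, the velocity of a path `u` of the method is
`proj (A(u) proj (g(u)))`. The projection reproduces the polynomials of degree less than `s`
(`proj_eval_smul`), because the rule is exact up to degree `2 k - 1` (`sum_weight_of_natDegree_lt`)
and the `P j` are orthonormal (`integral_P_mul_P`). Exactness requires that `P k` has `k` distinct
zeros in the unit interval: Rolle's theorem and Rodrigues' formula show that all its zeros are real
(`card_roots_P`), and orthogonality shows that they are simple and lie in the interval
(`not_nonneg_of_P_eq_mul`).

*Existence and uniqueness.* A path is determined by its values at the nodes, which solve a fixed
point equation. For small `h` this is a contraction of a ball around the constant `y₀`, and all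
solutions with nodal values in the compact set `K` are `O(h)`-close to `y₀`, hence in that ball
(`exists_unique_path`).

*Order.* Uniform estimates as `h → 0` are expressed by the predicate `UnifDiff τ n` on families of
curves on intervals `[0, τ i]`, which bounds the derivatives of order up to `n` uniformly over the
family. It is closed under products and under composition with smooth maps, and the projection
respects it (`UnifDiff.proj`), so all derivatives of the numerical solutions are bounded uniformly
(`unifDiff_path`). The residual `r = u' - A(u) g(u)` is then `O(h ^ s)` by Taylor's formula, and so
`e = u - y` is `O(h ^ (s + 1))`. Let `Ψ` solve `Ψ' = -Ψ Λ`, where `Λ` is the derivative of the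
vector field along `y`, with `Ψ(0)` the identity. Then `(Ψ e)' = Ψ r + O(h ^ (2 s + 2))`, and the
integral of `Ψ r` over the step differs from its quadrature by `O(h ^ (2 s + 1))`
(`UnifDiff.norm_sub_quad_le`).
Finally, `r` consists of projection errors, and a projection error is not only of order `h ^ s` but
also orthogonal to the polynomials of degree less than `s`, which approximate a smooth factor up to
`O(h ^ s)`. Hence the quadrature of `Ψ r` is `O(h ^ (2 s))` on the unit interval
(`norm_quad_resid_le`) and gains a factor `h` on `[0, h]`. Therefore `Ψ(h) e(h)`, from
which `e(h)` is recovered for small `h`, is `O(h ^ (2 s + 1))` (`norm_sub_solution_le`).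
-/

namespace PHBVM

open Polynomial Set

/-! ### Integrals of polynomials over the unit interval -/

lemma intervalIntegrable_eval (p : ℝ[X]) (a b : ℝ) :
    IntervalIntegrable (fun x => p.eval x) MeasureTheory.volume a b :=
  p.continuous.intervalIntegrable a b

lemma integral_eval_add (p q : ℝ[X]) :
    ∫ x in (0 : ℝ)..1, (p + q).eval x =
      (∫ x in (0 : ℝ)..1, p.eval x) + ∫ x in (0 : ℝ)..1, q.eval x := by
  simp only [eval_add]
  exact intervalIntegral.integral_add (intervalIntegrable_eval p _ _)
    (intervalIntegrable_eval q _ _)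

lemma integral_eval_C_mul (a : ℝ) (p : ℝ[X]) :
    ∫ x in (0 : ℝ)..1, (C a * p).eval x = a * ∫ x in (0 : ℝ)..1, p.eval x := by
  simp

lemma integral_eval_sum {ι : Type*} (S : Finset ι) (p : ι → ℝ[X]) :
    ∫ x in (0 : ℝ)..1, (∑ i ∈ S, p i).eval x = ∑ i ∈ S, ∫ x in (0 : ℝ)..1, (p i).eval x := by
  simp only [eval_finsetSum]
  exact intervalIntegral.integral_finsetSum fun i _ => intervalIntegrable_eval (p i) _ _

lemma integral_eval_derivative (p : ℝ[X]) (a b : ℝ) :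
    ∫ x in a..b, (derivative p).eval x = p.eval b - p.eval a :=
  intervalIntegral.integral_eq_sub_of_hasDerivAt (fun x _ => p.hasDerivAt x)
    (intervalIntegrable_eval _ _ _)

lemma integral_eval_X_pow (n : ℕ) : ∫ x in (0 : ℝ)..1, ((X : ℝ[X]) ^ n).eval x = 1 / (n + 1) := by
  simp

lemma integral_eval_pos {p : ℝ[X]} (hp : p ≠ 0) (h : ∀ x ∈ Icc (0 : ℝ) 1, 0 ≤ p.eval x) :
    0 < ∫ x in (0 : ℝ)..1, p.eval x := by
  refine intervalIntegral.integral_pos one_pos p.continuous.continuousOn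
    (fun x hx => h x ⟨hx.1.le, hx.2⟩) ?_
  by_contra! hcon
  refine hp (eq_zero_of_infinite_isRoot p ((Icc_infinite one_pos).mono fun x hx => ?_))
  exact le_antisymm (hcon x hx) (h x hx)

/-- Repeated integration by parts when the boundary terms vanish. -/
lemma integral_iterate_derivative_mul_eq_zero (n : ℕ) (W q : ℝ[X])
    (h0 : ∀ j < n, (derivative^[j] W).eval 0 = 0) (h1 : ∀ j < n, (derivative^[j] W).eval 1 = 0)
    (hq : derivative^[n] q = 0) :
    ∫ x in (0 : ℝ)..1, (derivative^[n] W * q).eval x = 0 := by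
  induction n generalizing q with
  | zero =>
    have : q = 0 := hq
    simp [this]
  | succ n ih =>
    have hd : derivative (derivative^[n] W * q) =
        derivative^[n + 1] W * q + derivative^[n] W * derivative q := by
      rw [derivative_mul, Function.iterate_succ_apply']
    have h2 := integral_eval_derivative (derivative^[n] W * q) 0 1
    rw [hd, integral_eval_add, ih (derivative q) (fun j hj => h0 j (hj.trans n.lt_succ_self))
      (fun j hj => h1 j (hj.trans n.lt_succ_self)) hq, eval_mul, eval_mul, h0 n n.lt_succ_self,
      h1 n n.lt_succ_self] at h2
    simpa using h2

/-! ### Orthonormality of the Legendre polynomials -/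

/-- The shifted Legendre polynomial of Mathlib, with real coefficients. -/
noncomputable def legendre (n : ℕ) : ℝ[X] := (shiftedLegendre n).map (Int.castRingHom ℝ)

lemma P_eq (n : ℕ) : P n = C ((-1) ^ n * Real.sqrt (2 * n + 1)) * legendre n := rfl

lemma P_scale_ne_zero (n : ℕ) : (-1) ^ n * Real.sqrt (2 * n + 1) ≠ 0 := by
  have : 0 < Real.sqrt (2 * n + 1) := Real.sqrt_pos.2 (by positivity)
  exact mul_ne_zero (pow_ne_zero _ (by norm_num)) this.ne'

lemma natDegree_legendre (n : ℕ) : (legendre n).natDegree = n := by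
  rw [legendre, natDegree_map_eq_of_injective (Int.castRingHom ℝ).injective_int,
    natDegree_shiftedLegendre]

lemma legendre_ne_zero (n : ℕ) : legendre n ≠ 0 := by
  rw [legendre, Polynomial.map_ne_zero_iff (Int.castRingHom ℝ).injective_int]
  intro h
  have := degree_shiftedLegendre n
  simp [h] at this

lemma natDegree_P (n : ℕ) : (P n).natDegree = n := by
  rw [P_eq, natDegree_C_mul (P_scale_ne_zero n), natDegree_legendre]

lemma P_ne_zero (n : ℕ) : P n ≠ 0 :=
  mul_ne_zero (C_ne_zero.2 (P_scale_ne_zero n)) (legendre_ne_zero n)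

/-- Rodrigues' formula. -/
lemma factorial_mul_legendre (n : ℕ) :
    C (n.factorial : ℝ) * legendre n = derivative^[n] (X ^ n * (1 - X) ^ n) := by
  have h := congrArg (Polynomial.map (Int.castRingHom ℝ)) (factorial_mul_shiftedLegendre_eq n)
  rw [← iterate_derivative_map] at h
  simpa [legendre] using h

lemma integral_legendre_mul_eq_zero {n : ℕ} {q : ℝ[X]} (hq : q.natDegree < n) :
    ∫ x in (0 : ℝ)..1, (legendre n * q).eval x = 0 := by
  have hW : ∀ j < n, ∀ r : ℝ[X], r ^ n ∣ (X ^ n * (1 - X) ^ n : ℝ[X]) →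
      r ∣ derivative^[j] (X ^ n * (1 - X) ^ n : ℝ[X]) := fun j hj r hr =>
    (dvd_pow_self r (by omega)).trans (pow_sub_dvd_iterate_derivative_of_pow_dvd j hr)
  have h := integral_iterate_derivative_mul_eq_zero n (X ^ n * (1 - X) ^ n) q
    (fun j hj => eval_eq_zero_of_dvd_of_eval_eq_zero (hW j hj X (dvd_mul_right _ _)) (by simp))
    (fun j hj => eval_eq_zero_of_dvd_of_eval_eq_zero (hW j hj (1 - X) (dvd_mul_left _ _)) (by simp))
    (iterate_derivative_eq_zero hq)
  rw [← factorial_mul_legendre, mul_assoc, integral_eval_C_mul] at h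
  exact (mul_eq_zero.1 h).resolve_left (by positivity)

lemma legendre_eval_zero (n : ℕ) : (legendre n).eval 0 = 1 := by
  rw [← coeff_zero_eq_eval_zero, legendre, coeff_map, coeff_shiftedLegendre]
  simp

lemma legendre_eval_one_sq (n : ℕ) : (legendre n).eval 1 ^ 2 = 1 := by
  have h := shiftedLegendre_eval_symm n (1 : ℝ)
  have h2 : ∀ x : ℝ, aeval x (shiftedLegendre n) = (legendre n).eval x := fun x => by
    rw [legendre, eval_map, aeval_def]; rfl
  rw [h2, h2, sub_self, legendre_eval_zero, mul_one] at h
  rw [h, ← pow_mul, mul_comm, pow_mul]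
  simp

/-- Integrating `(x L²)'` for the Legendre polynomial `L` of degree `n` gives
`L(1)² = ∫ L² + 2 ∫ L (x L')`, and `x L' - n L` has degree less than `n`. -/
lemma integral_legendre_sq (n : ℕ) :
    (2 * n + 1) * ∫ x in (0 : ℝ)..1, (legendre n * legendre n).eval x = 1 := by
  have h1 := integral_eval_derivative (X * (legendre n * legendre n)) 0 1
  have hd : derivative (X * (legendre n * legendre n)) = legendre n * legendre n +
      C 2 * (C (n : ℝ) * (legendre n * legendre n) +
        legendre n * (X * derivative (legendre n) - C (n : ℝ) * legendre n)) := by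
    simp only [derivative_mul, derivative_X]
    have : (C 2 : ℝ[X]) = 2 := rfl
    rw [this]
    ring
  have h0 : ∫ x in (0 : ℝ)..1,
      (legendre n * (X * derivative (legendre n) - C (n : ℝ) * legendre n)).eval x = 0 := by
    rcases Nat.eq_zero_or_pos n with rfl | hn
    · have : derivative (legendre 0) = 0 := derivative_of_natDegree_zero (natDegree_legendre 0)
      simp [this]
    · refine integral_legendre_mul_eq_zero ?_
      refine Nat.lt_of_le_pred hn (natDegree_le_iff_coeff_eq_zero.2 fun j hj => ?_)
      replace hj : n ≤ j := Nat.le_of_pred_lt hj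
      obtain ⟨j, rfl⟩ : ∃ i, j = i + 1 := ⟨j - 1, by omega⟩
      rw [coeff_sub, coeff_X_mul, coeff_derivative, coeff_C_mul]
      rcases hj.lt_or_eq with h | h
      · rw [coeff_eq_zero_of_natDegree_lt (by rw [natDegree_legendre]; exact h)]
        simp
      · rw [h]; push_cast; ring
  rw [hd, integral_eval_add, integral_eval_C_mul, integral_eval_add, integral_eval_C_mul, h0] at h1
  simp only [eval_mul, eval_X] at h1 ⊢
  have := legendre_eval_one_sq n
  nlinarith

lemma integral_P_mul_eq_zero {n : ℕ} {q : ℝ[X]} (hq : q.natDegree < n) :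
    ∫ x in (0 : ℝ)..1, (P n * q).eval x = 0 := by
  rw [P_eq, mul_assoc, integral_eval_C_mul, integral_legendre_mul_eq_zero hq, mul_zero]

lemma integral_P_mul_P (i j : ℕ) :
    ∫ x in (0 : ℝ)..1, (P i * P j).eval x = if i = j then 1 else 0 := by
  split_ifs with h
  · subst h
    have h2 : P i * P i = C (2 * (i : ℝ) + 1) * (legendre i * legendre i) := by
      have h3 : ((-1) ^ i * Real.sqrt (2 * i + 1)) * ((-1) ^ i * Real.sqrt (2 * i + 1)) =
          2 * (i : ℝ) + 1 := by
        rw [mul_mul_mul_comm, ← mul_pow, Real.mul_self_sqrt (by positivity)]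
        simp
      rw [← h3, C_mul, P_eq]
      ring
    rw [h2, integral_eval_C_mul, integral_legendre_sq]
  · rcases lt_or_gt_of_ne h with h | h
    · rw [mul_comm]
      exact integral_P_mul_eq_zero (by rwa [natDegree_P])
    · exact integral_P_mul_eq_zero (by rwa [natDegree_P])

/-! ### Zeros of the Legendre polynomials -/

/-- `P n` has no nonconstant factor `d` that is nonnegative on the unit interval: otherwise
`∫ P n * q = ∫ d * q ^ 2 > 0` for the cofactor `q`, although `q` has degree less than `n`. -/
lemma not_nonneg_of_P_eq_mul {n : ℕ} {d q : ℝ[X]} (h : P n = d * q) (hq : q.natDegree < n)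
    (hd : ∀ x ∈ Icc (0 : ℝ) 1, 0 ≤ d.eval x) : False := by
  have hne : d * q ≠ 0 := h ▸ P_ne_zero n
  have h1 := integral_P_mul_eq_zero hq
  rw [h] at h1
  refine (integral_eval_pos (p := d * q * q) (mul_ne_zero hne (right_ne_zero_of_mul hne))
    fun x hx => ?_).ne' h1
  rw [eval_mul, eval_mul, mul_assoc]
  exact mul_nonneg (hd x hx) (mul_self_nonneg _)

lemma natDegree_lt_of_P_eq_mul {n : ℕ} {d q : ℝ[X]} (h : P n = d * q) (hd : 0 < d.natDegree) :
    q.natDegree < n := by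
  have hne : d * q ≠ 0 := h ▸ P_ne_zero n
  have := natDegree_mul (left_ne_zero_of_mul hne) (right_ne_zero_of_mul hne)
  rw [← h, natDegree_P] at this
  omega

lemma mem_Icc_of_mem_nodes {k : ℕ} {c : ℝ} (hc : c ∈ nodes k) : c ∈ Icc (0 : ℝ) 1 := by
  rw [nodes, Multiset.mem_toFinset, mem_roots (P_ne_zero k)] at hc
  obtain ⟨q, hq⟩ := dvd_iff_isRoot.2 hc
  have hdeg := natDegree_lt_of_P_eq_mul hq (by simp)
  by_contra hcon
  rw [mem_Icc, not_and_or, not_le, not_le] at hcon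
  rcases hcon with h | h
  · refine not_nonneg_of_P_eq_mul hq hdeg fun x hx => ?_
    rw [eval_sub, eval_X, eval_C]
    linarith [hx.1]
  · refine not_nonneg_of_P_eq_mul (d := -(X - C c)) (q := -q) (by rw [hq]; ring)
      (by rwa [natDegree_neg]) fun x hx => ?_
    rw [eval_neg, eval_sub, eval_X, eval_C]
    linarith [hx.2]

lemma nodup_roots_P (k : ℕ) : (P k).roots.Nodup := by
  rw [Multiset.nodup_iff_count_le_one]
  intro c
  by_contra! hcon
  rw [count_roots] at hcon
  obtain ⟨q, hq⟩ := (le_rootMultiplicity_iff (P_ne_zero k)).1 hcon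
  refine not_nonneg_of_P_eq_mul hq (natDegree_lt_of_P_eq_mul hq ?_) fun x _ => ?_
  · rw [natDegree_pow, natDegree_X_sub_C]; norm_num
  · rw [eval_pow]; exact sq_nonneg _

lemma card_roots_le_iterate_derivative (p : ℝ[X]) (n : ℕ) :
    p.roots.card ≤ (derivative^[n] p).roots.card + n := by
  induction n with
  | zero => simp
  | succ n ih =>
    have := card_roots_le_derivative (derivative^[n] p)
    rw [Function.iterate_succ_apply']
    omega

/-- By Rolle's theorem, the `k`-th derivative of `x ^ k (1 - x) ^ k` has at least `k` of the `2 k`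
zeros of that polynomial left. -/
lemma card_roots_P (k : ℕ) : (P k).roots.card = k := by
  refine le_antisymm ((card_roots' _).trans_eq (natDegree_P k)) ?_
  have hs : (X ^ k * (1 - X) ^ k : ℝ[X]).roots.card = 2 * k := by
    have h1 : (1 - X : ℝ[X]) = C (-1) * (X - C 1) := by simp
    have h2 : (X ^ k * (1 - X) ^ k : ℝ[X]) ≠ 0 := by
      rw [h1]
      exact mul_ne_zero (pow_ne_zero _ X_ne_zero)
        (pow_ne_zero _ (mul_ne_zero (C_ne_zero.2 (by norm_num)) (X_sub_C_ne_zero 1)))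
    rw [roots_mul h2, roots_pow, roots_pow, h1, roots_C_mul _ (by norm_num), roots_X_sub_C, roots_X]
    simp [two_mul]
  have h := card_roots_le_iterate_derivative (X ^ k * (1 - X) ^ k) k
  rw [hs, ← factorial_mul_legendre, roots_C_mul _ (by positivity)] at h
  rw [P_eq, roots_C_mul _ (P_scale_ne_zero k)]
  omega

lemma card_nodes (k : ℕ) : (nodes k).card = k := by
  rw [nodes, Multiset.toFinset_card_of_nodup (nodup_roots_P k), card_roots_P]

lemma eval_P_of_mem_nodes {k : ℕ} {c : ℝ} (hc : c ∈ nodes k) : (P k).eval c = 0 := by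
  rw [nodes, Multiset.mem_toFinset, mem_roots (P_ne_zero k)] at hc
  exact hc

/-! ### Exactness of Gauss-Legendre quadrature -/

lemma sum_weight_of_degree_lt {k : ℕ} {p : ℝ[X]} (hp : p.degree < k) :
    ∑ c ∈ nodes k, weight k c * p.eval c = ∫ x in (0 : ℝ)..1, p.eval x := by
  have h := Lagrange.eq_interpolate (s := nodes k) (v := id) (f := p) (injOn_id _)
    (by rwa [card_nodes])
  conv_rhs => rw [h, Lagrange.interpolate_apply]
  rw [integral_eval_sum]
  refine Finset.sum_congr rfl fun c _ => ?_
  rw [integral_eval_C_mul, weight, id, mul_comm]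

lemma sum_weight_of_natDegree_lt {k : ℕ} {p : ℝ[X]} (hp : p.natDegree < 2 * k) :
    ∑ c ∈ nodes k, weight k c * p.eval c = ∫ x in (0 : ℝ)..1, p.eval x := by
  have hk : 0 < k := by omega
  have hdiv := EuclideanDomain.mod_add_div p (P k)
  have hmod : (p % P k).degree < k := by
    have : (p % P k).degree < (P k).degree := EuclideanDomain.mod_lt p (P_ne_zero k)
    rwa [degree_eq_natDegree (P_ne_zero k), natDegree_P] at this
  have hq : (p / P k).natDegree < k := by
    have hmonic := monic_mul_leadingCoeff_inv (P_ne_zero k)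
    have hlc : ((P k).leadingCoeff)⁻¹ ≠ 0 := inv_ne_zero (leadingCoeff_ne_zero.2 (P_ne_zero k))
    rw [div_def, natDegree_C_mul hlc, natDegree_divByMonic _ hmonic, natDegree_mul_C hlc,
      natDegree_P]
    omega
  rw [← hdiv, integral_eval_add, integral_P_mul_eq_zero hq, add_zero,
    ← sum_weight_of_degree_lt hmod]
  refine Finset.sum_congr rfl fun c hc => ?_
  rw [eval_add, eval_mul, eval_P_of_mem_nodes hc]
  ring

/-! ### Families of curves with uniformly bounded derivatives -/

section Families

universe u v

variable {ι : Type v} {τ : ι → ℝ}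
variable {E F G : Type u} [NormedAddCommGroup E] [NormedSpace ℝ E] [NormedAddCommGroup F]
  [NormedSpace ℝ F] [NormedAddCommGroup G] [NormedSpace ℝ G]

/-- `UnifDiff τ n f` says that the curves `f i : [0, τ i] → E` have `n` derivatives, all of them
bounded uniformly in `i` as well. The derivatives are not required to be continuous. -/
def UnifDiff (τ : ι → ℝ) : ℕ → (ι → ℝ → E) → Prop
  | 0, f => ∃ C, ∀ i, ∀ t ∈ Icc 0 (τ i), ‖f i t‖ ≤ C
  | n + 1, f => (∃ C, ∀ i, ∀ t ∈ Icc 0 (τ i), ‖f i t‖ ≤ C) ∧ ∃ f' : ι → ℝ → E,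
      UnifDiff τ n f' ∧
        ∀ i, ∀ t ∈ Icc 0 (τ i), HasDerivWithinAt (f i) (f' i t) (Icc 0 (τ i)) t

namespace UnifDiff

lemma bound {n : ℕ} {f : ι → ℝ → E} (hf : UnifDiff τ n f) :
    ∃ C, 0 ≤ C ∧ ∀ i, ∀ t ∈ Icc 0 (τ i), ‖f i t‖ ≤ C := by
  have h : ∃ C, ∀ i, ∀ t ∈ Icc 0 (τ i), ‖f i t‖ ≤ C := by
    cases n with
    | zero => exact hf
    | succ n => exact hf.1
  obtain ⟨C, hC⟩ := h
  exact ⟨max C 0, le_max_right _ _, fun i t ht => (hC i t ht).trans (le_max_left _ _)⟩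

lemma succ_intro {n : ℕ} {f f' : ι → ℝ → E} (hf : UnifDiff τ 0 f) (hf' : UnifDiff τ n f')
    (h : ∀ i, ∀ t ∈ Icc 0 (τ i), HasDerivWithinAt (f i) (f' i t) (Icc 0 (τ i)) t) :
    UnifDiff τ (n + 1) f :=
  ⟨hf, f', hf', h⟩

lemma zero {n : ℕ} {f : ι → ℝ → E} (hf : UnifDiff τ n f) : UnifDiff τ 0 f :=
  let ⟨C, _, hC⟩ := hf.bound
  ⟨C, hC⟩

lemma of_succ {n : ℕ} {f : ι → ℝ → E} (hf : UnifDiff τ (n + 1) f) : UnifDiff τ n f := by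
  induction n generalizing f with
  | zero => exact hf.zero
  | succ n ih =>
    obtain ⟨h0, f', hf', h⟩ := hf
    exact ⟨h0, f', ih hf', h⟩

lemma mono {m n : ℕ} {f : ι → ℝ → E} (hf : UnifDiff τ n f) (hmn : m ≤ n) : UnifDiff τ m f := by
  induction hmn with
  | refl => exact hf
  | step _ ih => exact ih hf.of_succ

lemma congr {n : ℕ} {f g : ι → ℝ → E} (hf : UnifDiff τ n f)
    (h : ∀ i, ∀ t ∈ Icc 0 (τ i), g i t = f i t) : UnifDiff τ n g := by
  cases n with
  | zero =>
    obtain ⟨C, hC⟩ := hf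
    exact ⟨C, fun i t ht => (h i t ht).symm ▸ hC i t ht⟩
  | succ n =>
    obtain ⟨⟨C, hC⟩, f', hf', hd⟩ := hf
    exact ⟨⟨C, fun i t ht => (h i t ht).symm ▸ hC i t ht⟩, f', hf',
      fun i t ht => (hd i t ht).congr (h i) (h i t ht)⟩

lemma const {n : ℕ} {a : ι → E} {C : ℝ} (h : ∀ i, ‖a i‖ ≤ C) :
    UnifDiff τ n fun i _ => a i := by
  induction n generalizing a C with
  | zero => exact ⟨C, fun i _ _ => h i⟩
  | succ n ih =>
    exact ⟨⟨C, fun i _ _ => h i⟩, fun _ _ => 0, ih (a := fun _ => 0) (C := 0) (by simp),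
      fun i t _ => hasDerivWithinAt_const _ _ _⟩

lemma add {n : ℕ} {f g : ι → ℝ → E} (hf : UnifDiff τ n f) (hg : UnifDiff τ n g) :
    UnifDiff τ n fun i t => f i t + g i t := by
  induction n generalizing f g with
  | zero =>
    obtain ⟨C, hC⟩ := hf
    obtain ⟨D, hD⟩ := hg
    exact ⟨C + D, fun i t ht => (norm_add_le _ _).trans (add_le_add (hC i t ht) (hD i t ht))⟩
  | succ n ih =>
    obtain ⟨⟨C, hC⟩, f', hf', hfd⟩ := hf
    obtain ⟨⟨D, hD⟩, g', hg', hgd⟩ := hg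
    exact ⟨⟨C + D, fun i t ht => (norm_add_le _ _).trans (add_le_add (hC i t ht) (hD i t ht))⟩,
      _, ih hf' hg', fun i t ht => (hfd i t ht).add (hgd i t ht)⟩

lemma sum {α : Type*} (S : Finset α) {n : ℕ} {f : α → ι → ℝ → E}
    (hf : ∀ a ∈ S, UnifDiff τ n (f a)) : UnifDiff τ n fun i t => ∑ a ∈ S, f a i t := by
  classical
  induction S using Finset.induction_on with
  | empty =>
    simpa using const (τ := τ) (n := n) (a := fun _ : ι => (0 : E)) (C := 0) (by simp)
  | insert a S ha ih =>
    refine ((hf a (Finset.mem_insert_self a S)).add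
      (ih fun b hb => hf b (Finset.mem_insert_of_mem hb))).congr fun i t _ => ?_
    rw [Finset.sum_insert ha]

lemma bilin_zero (L : E →L[ℝ] F →L[ℝ] G) {n : ℕ} {f : ι → ℝ → E} {g : ι → ℝ → F}
    (hf : UnifDiff τ n f) (hg : UnifDiff τ n g) : UnifDiff τ 0 fun i t => L (f i t) (g i t) := by
  obtain ⟨C, hC0, hC⟩ := hf.bound
  obtain ⟨D, hD0, hD⟩ := hg.bound
  refine ⟨‖L‖ * C * D, fun i t ht => (L.le_opNorm₂ _ _).trans ?_⟩
  gcongr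
  exacts [hC i t ht, hD i t ht]

lemma bilin (L : E →L[ℝ] F →L[ℝ] G) {n : ℕ} {f : ι → ℝ → E} {g : ι → ℝ → F}
    (hf : UnifDiff τ n f) (hg : UnifDiff τ n g) : UnifDiff τ n fun i t => L (f i t) (g i t) := by
  induction n generalizing f g with
  | zero => exact hf.bilin_zero L hg
  | succ n ih =>
    obtain ⟨-, f', hf', hfd⟩ := id hf
    obtain ⟨-, g', hg', hgd⟩ := id hg
    exact (hf.bilin_zero L hg).succ_intro ((ih hf.of_succ hg').add (ih hf' hg.of_succ))
      fun i t ht => L.hasDerivWithinAt_of_bilinear (hfd i t ht) (hgd i t ht)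

lemma clm (L : E →L[ℝ] F) {n : ℕ} {f : ι → ℝ → E} (hf : UnifDiff τ n f) :
    UnifDiff τ n fun i t => L (f i t) :=
  bilin (ContinuousLinearMap.apply ℝ F).flip (f := fun _ _ => L)
    (const (C := ‖L‖) fun _ => le_rfl) hf

lemma apply {n : ℕ} {f : ι → ℝ → E →L[ℝ] F} {g : ι → ℝ → E} (hf : UnifDiff τ n f)
    (hg : UnifDiff τ n g) : UnifDiff τ n fun i t => f i t (g i t) :=
  bilin (ContinuousLinearMap.id ℝ (E →L[ℝ] F)) hf hg

lemma neg {n : ℕ} {f : ι → ℝ → E} (hf : UnifDiff τ n f) : UnifDiff τ n fun i t => -f i t :=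
  hf.clm (-ContinuousLinearMap.id ℝ E)

lemma sub {n : ℕ} {f g : ι → ℝ → E} (hf : UnifDiff τ n f) (hg : UnifDiff τ n g) :
    UnifDiff τ n fun i t => f i t - g i t :=
  (hf.add hg.neg).congr fun _ _ _ => sub_eq_add_neg _ _

/-- By the chain rule the derivative of `g ∘ f` is the product of `g' ∘ f` and `f'`, which makes
induction on the order possible. -/
lemma comp {n : ℕ} {U K : Set E} (hU : IsOpen U) (hK : IsCompact K) (hKU : K ⊆ U) {g : E → F}
    (hg : ContDiffOn ℝ n g U) {f : ι → ℝ → E} (hf : UnifDiff τ n f)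
    (hfK : ∀ i, ∀ t ∈ Icc 0 (τ i), f i t ∈ K) : UnifDiff τ n fun i t => g (f i t) := by
  have h0 : UnifDiff τ 0 fun i t => g (f i t) := by
    obtain ⟨C, hC⟩ := hK.exists_bound_of_continuousOn (hg.continuousOn.mono hKU)
    exact ⟨C, fun i t ht => hC _ (hfK i t ht)⟩
  induction n generalizing F with
  | zero => exact h0
  | succ n ih =>
    obtain ⟨-, f', hf', hfd⟩ := id hf
    have hg' : ContDiffOn ℝ n (fderiv ℝ g) U := hg.fderiv_of_isOpen hU (by simp)
    have hc : UnifDiff τ 0 fun i t => fderiv ℝ g (f i t) := by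
      obtain ⟨C, hC⟩ := hK.exists_bound_of_continuousOn (hg'.continuousOn.mono hKU)
      exact ⟨C, fun i t ht => hC _ (hfK i t ht)⟩
    refine h0.succ_intro ((ih hg' hf.of_succ hc).apply hf') fun i t ht => ?_
    have hd : DifferentiableAt ℝ g (f i t) :=
      (hg.differentiableOn (by simp)).differentiableAt (hU.mem_nhds (hKU (hfK i t ht)))
    exact hd.hasFDerivAt.comp_hasDerivWithinAt t (hfd i t ht)

/-- Taylor expansion at `0`, with a remainder that is uniform over the family. -/
lemma taylor {n : ℕ} {f : ι → ℝ → E} (hτ : ∀ i, 0 ≤ τ i) (hf : UnifDiff τ n f) :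
    ∃ C, 0 ≤ C ∧ ∀ i, ∃ a : ℕ → E, (∀ j, ‖a j‖ ≤ C) ∧
      ∀ t ∈ Icc 0 (τ i), ‖f i t - ∑ j ∈ Finset.range n, t ^ j • a j‖ ≤ C * τ i ^ n := by
  induction n generalizing f with
  | zero =>
    obtain ⟨C, hC0, hC⟩ := hf.bound
    exact ⟨C, hC0, fun i => ⟨0, by simpa using hC0, fun t ht => by simpa using hC i t ht⟩⟩
  | succ n ih =>
    obtain ⟨-, f', hf', hfd⟩ := id hf
    obtain ⟨C, hC0, hC⟩ := ih hf'
    obtain ⟨D, hD0, hD⟩ := hf.bound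
    refine ⟨max C D, le_max_of_le_left hC0, fun i => ?_⟩
    obtain ⟨b, hb, hR⟩ := hC i
    refine ⟨fun j => Nat.casesOn j (f i 0) fun j => ((j : ℝ) + 1)⁻¹ • b j, ?_, fun t ht => ?_⟩
    · rintro (_ | j)
      · exact (hD i 0 ⟨le_rfl, hτ i⟩).trans (le_max_right _ _)
      · refine le_trans ?_ (le_max_left _ _)
        rw [norm_smul, norm_inv, Real.norm_of_nonneg (by positivity)]
        refine (mul_le_of_le_one_left (norm_nonneg _) (inv_le_one_of_one_le₀ ?_)).trans (hb j)
        linarith [(j.cast_nonneg : (0 : ℝ) ≤ j)]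
    · rw [Finset.sum_range_succ']
      have hderiv : ∀ x ∈ Icc 0 (τ i), HasDerivWithinAt
          (fun x => f i x - ∑ j ∈ Finset.range n, x ^ (j + 1) • ((j : ℝ) + 1)⁻¹ • b j)
          (f' i x - ∑ j ∈ Finset.range n, x ^ j • b j) (Icc 0 (τ i)) x := by
        intro x hx
        refine (hfd i x hx).sub (HasDerivWithinAt.fun_sum fun j _ => ?_)
        refine (((hasDerivAt_pow (j + 1) x).smul_const _).hasDerivWithinAt).congr_deriv ?_
        rw [smul_smul]
        congr 1
        push_cast
        field_simp
      have h := norm_image_sub_le_of_norm_deriv_le_segment' hderiv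
        (fun x hx => hR x (Ico_subset_Icc_self hx)) t ht
      simp only [ne_eq, Nat.add_eq_zero_iff, one_ne_zero, and_false, not_false_eq_true, zero_pow,
        zero_smul, Finset.sum_const_zero, sub_zero] at h
      simp only [pow_zero, one_smul, sub_add_eq_sub_sub]
      refine h.trans ?_
      rw [pow_succ, ← mul_assoc]
      exact mul_le_mul (mul_le_mul_of_nonneg_right (le_max_left _ _) (pow_nonneg (hτ i) n)) ht.2
        ht.1 (mul_nonneg (le_max_of_le_left hC0) (pow_nonneg (hτ i) n))

lemma eval_smul_zero (hτ : ∀ i, 0 < τ i) (hτ1 : ∀ i, τ i ≤ 1) {n : ℕ} (p : ℝ[X]) {v : ι → E}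
    {C : ℝ} (hv : ∀ i, ‖v i‖ ≤ C * τ i ^ n) : UnifDiff τ 0 fun i t => p.eval (t / τ i) • v i := by
  obtain ⟨D, hD⟩ := isCompact_Icc.exists_bound_of_continuousOn
    (p.continuous.continuousOn (s := Icc 0 1))
  have hD0 : 0 ≤ D := (norm_nonneg _).trans (hD 0 (by simp))
  refine ⟨D * |C|, fun i t ht => ?_⟩
  rw [norm_smul]
  have h1 := hD (t / τ i) ⟨div_nonneg ht.1 (hτ i).le, div_le_one_of_le₀ ht.2 (hτ i).le⟩
  have h2 : ‖v i‖ ≤ |C| := (hv i).trans <| by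
    refine (mul_le_mul_of_nonneg_right (le_abs_self C) (pow_nonneg (hτ i).le n)).trans ?_
    exact mul_le_of_le_one_right (abs_nonneg _) (pow_le_one₀ (hτ i).le (hτ1 i))
  gcongr

/-- Rescaled polynomials: differentiating costs a factor `(τ i)⁻¹`, which `n` times can be
taken from the coefficient, and lowers the degree. -/
lemma eval_smul (hτ : ∀ i, 0 < τ i) (hτ1 : ∀ i, τ i ≤ 1) {N n : ℕ} {p : ℝ[X]} {v : ι → E}
    (h : p.natDegree ≤ n ∨ N ≤ n) {C : ℝ} (hv : ∀ i, ‖v i‖ ≤ C * τ i ^ n) :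
    UnifDiff τ N fun i t => p.eval (t / τ i) • v i := by
  induction N generalizing n p v with
  | zero => exact eval_smul_zero hτ hτ1 p hv
  | succ N ih =>
    have hd : ∀ i t, HasDerivAt (fun t => p.eval (t / τ i) • v i)
        ((derivative p).eval (t / τ i) • (τ i)⁻¹ • v i) t := by
      intro i t
      refine (((p.hasDerivAt (t / τ i)).comp t ((hasDerivAt_id t).div_const _)).smul_const
        (v i)).congr_deriv ?_
      rw [smul_smul]
      simp [div_eq_mul_inv]
    have key : UnifDiff τ N fun i t => (derivative p).eval (t / τ i) • (τ i)⁻¹ • v i := by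
      cases n with
      | zero =>
        have hp : derivative p = 0 := derivative_of_natDegree_zero (by omega)
        simpa [hp] using const (τ := τ) (n := N) (a := fun _ : ι => (0 : E)) (C := 0) (by simp)
      | succ n =>
        refine ih (n := n) ?_ fun i => ?_
        · have := natDegree_derivative_le p
          omega
        · rw [norm_smul, norm_inv, Real.norm_of_nonneg (hτ i).le, inv_mul_le_iff₀ (hτ i)]
          refine (hv i).trans_eq ?_
          ring
    exact (eval_smul_zero hτ hτ1 p hv).succ_intro key fun i t _ => (hd i t).hasDerivWithinAt

end UnifDiff
end Families

/-! ### The discrete Legendre projection -/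

section Projection

universe u v

variable {E F G : Type u} [NormedAddCommGroup E] [NormedSpace ℝ E] [NormedAddCommGroup F]
  [NormedSpace ℝ F] [NormedAddCommGroup G] [NormedSpace ℝ G]

/-- The `k`-point Gauss-Legendre quadrature rule on `[0,1]` for vector valued functions. -/
noncomputable def quad (k : ℕ) (φ : ℝ → E) : E := ∑ c ∈ nodes k, weight k c • φ c

/-- The discrete Legendre coefficient of index `j`. -/
noncomputable def coef (k j : ℕ) (φ : ℝ → E) : E := quad k fun c => (P j).eval c • φ c

/-- The orthogonal projection of `φ` onto the polynomials of degree less than `s`, with respect to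
the discrete inner product given by the quadrature rule. -/
noncomputable def proj (k s : ℕ) (φ : ℝ → E) (x : ℝ) : E :=
  ∑ j ∈ Finset.range s, (P j).eval x • coef k j φ

lemma quad_congr {k : ℕ} {φ ψ : ℝ → E} (h : ∀ c ∈ nodes k, φ c = ψ c) : quad k φ = quad k ψ :=
  Finset.sum_congr rfl fun c hc => by rw [h c hc]

lemma quad_add (k : ℕ) (φ ψ : ℝ → E) : quad k (fun c => φ c + ψ c) = quad k φ + quad k ψ := by
  simp only [quad, smul_add, Finset.sum_add_distrib]

lemma quad_sub (k : ℕ) (φ ψ : ℝ → E) : quad k (fun c => φ c - ψ c) = quad k φ - quad k ψ := by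
  simp only [quad, smul_sub, Finset.sum_sub_distrib]

lemma quad_neg (k : ℕ) (φ : ℝ → E) : quad k (fun c => -φ c) = -quad k φ := by
  simp only [quad, smul_neg, Finset.sum_neg_distrib]

lemma quad_sum {α : Type*} (k : ℕ) (S : Finset α) (φ : α → ℝ → E) :
    quad k (fun c => ∑ a ∈ S, φ a c) = ∑ a ∈ S, quad k (φ a) := by
  simp only [quad, Finset.smul_sum]
  exact Finset.sum_comm

lemma quad_map (k : ℕ) (L : E →L[ℝ] F) (φ : ℝ → E) :
    quad k (fun c => L (φ c)) = L (quad k φ) := by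
  simp only [quad, map_sum, map_smul]

lemma quad_eval_smul {k : ℕ} {p : ℝ[X]} (hp : p.natDegree < 2 * k) (v : E) :
    quad k (fun c => p.eval c • v) = (∫ x in (0 : ℝ)..1, p.eval x) • v := by
  simp only [quad, smul_smul]
  rw [← Finset.sum_smul, sum_weight_of_natDegree_lt hp]

lemma norm_quad_le {k : ℕ} {φ : ℝ → E} {M : ℝ} (h : ∀ c ∈ nodes k, ‖φ c‖ ≤ M) :
    ‖quad k φ‖ ≤ (∑ c ∈ nodes k, |weight k c|) * M := by
  rw [Finset.sum_mul]
  refine (norm_sum_le _ _).trans (Finset.sum_le_sum fun c hc => ?_)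
  rw [norm_smul, Real.norm_eq_abs]
  exact mul_le_mul_of_nonneg_left (h c hc) (abs_nonneg _)

lemma coef_congr {k j : ℕ} {φ ψ : ℝ → E} (h : ∀ c ∈ nodes k, φ c = ψ c) :
    coef k j φ = coef k j ψ :=
  quad_congr fun c hc => by rw [h c hc]

lemma coef_add (k j : ℕ) (φ ψ : ℝ → E) :
    coef k j (fun c => φ c + ψ c) = coef k j φ + coef k j ψ := by
  simp only [coef, smul_add, quad_add]

lemma coef_sum {α : Type*} (k j : ℕ) (S : Finset α) (φ : α → ℝ → E) :
    coef k j (fun c => ∑ a ∈ S, φ a c) = ∑ a ∈ S, coef k j (φ a) := by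
  simp only [coef, Finset.smul_sum, quad_sum]

lemma exists_norm_coef_le (k j : ℕ) : ∃ D, 0 ≤ D ∧ ∀ (φ : ℝ → E) (M : ℝ), 0 ≤ M →
    (∀ c ∈ nodes k, ‖φ c‖ ≤ M) → ‖coef k j φ‖ ≤ D * M := by
  obtain ⟨B, hB⟩ := isCompact_Icc.exists_bound_of_continuousOn
    ((P j).continuous.continuousOn (s := Icc 0 1))
  have hB0 : 0 ≤ B := (norm_nonneg _).trans (hB 0 (by simp))
  refine ⟨(∑ c ∈ nodes k, |weight k c|) * B,
    mul_nonneg (Finset.sum_nonneg fun _ _ => abs_nonneg _) hB0, fun φ M hM h => ?_⟩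
  rw [mul_assoc]
  refine norm_quad_le fun c hc => ?_
  rw [norm_smul]
  exact mul_le_mul (hB c (mem_Icc_of_mem_nodes hc)) (h c hc) (norm_nonneg _) hB0

lemma proj_congr {k s : ℕ} {φ ψ : ℝ → E} (h : ∀ c ∈ nodes k, φ c = ψ c) :
    proj k s φ = proj k s ψ := by
  funext x
  exact Finset.sum_congr rfl fun j _ => by rw [coef_congr h]

lemma proj_add (k s : ℕ) (φ ψ : ℝ → E) (x : ℝ) :
    proj k s (fun c => φ c + ψ c) x = proj k s φ x + proj k s ψ x := by
  simp only [proj, coef_add, smul_add, Finset.sum_add_distrib]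

lemma proj_sum {α : Type*} (k s : ℕ) (S : Finset α) (φ : α → ℝ → E) (x : ℝ) :
    proj k s (fun c => ∑ a ∈ S, φ a c) x = ∑ a ∈ S, proj k s (φ a) x := by
  simp only [proj, coef_sum, Finset.smul_sum]
  exact Finset.sum_comm

lemma exists_norm_proj_le (k s : ℕ) : ∃ D, 0 ≤ D ∧ ∀ (φ : ℝ → E) (M : ℝ), 0 ≤ M →
    (∀ c ∈ nodes k, ‖φ c‖ ≤ M) → ∀ x ∈ Icc (0 : ℝ) 1, ‖proj k s φ x‖ ≤ D * M := by
  choose D hD0 hD using fun j => exists_norm_coef_le (E := E) k j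
  choose B hB using fun j => isCompact_Icc.exists_bound_of_continuousOn
    ((P j).continuous.continuousOn (s := Icc 0 1))
  have hB0 : ∀ j, 0 ≤ B j := fun j => (norm_nonneg _).trans (hB j 0 (by simp))
  refine ⟨∑ j ∈ Finset.range s, B j * D j,
    Finset.sum_nonneg fun j _ => mul_nonneg (hB0 j) (hD0 j), fun φ M hM h x hx => ?_⟩
  rw [Finset.sum_mul]
  refine (norm_sum_le _ _).trans (Finset.sum_le_sum fun j _ => ?_)
  rw [norm_smul, mul_assoc]
  exact mul_le_mul (hB j x hx) (hD j φ M hM h) (norm_nonneg _) (hB0 j)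

lemma coef_P_smul {k i j : ℕ} (hi : i < k) (hj : j < k) (v : E) :
    coef k j (fun c => (P i).eval c • v) = (if i = j then (1 : ℝ) else 0) • v := by
  have h : (P j * P i).natDegree < 2 * k := by
    rw [natDegree_mul (P_ne_zero j) (P_ne_zero i), natDegree_P, natDegree_P]
    omega
  simp only [coef, smul_smul, ← eval_mul]
  rw [quad_eval_smul h, mul_comm, integral_P_mul_P]

/-- The projection reproduces the polynomials of degree less than `s`. -/
lemma proj_eval_smul {k s : ℕ} (hsk : s ≤ k) {p : ℝ[X]} (hp : p.degree < s) (v : E) (x : ℝ) :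
    proj k s (fun c => p.eval c • v) x = p.eval x • v := by
  suffices h : ∀ n ≤ s, ∀ p : ℝ[X], p.degree < n →
      proj k s (fun c => p.eval c • v) x = p.eval x • v from h s le_rfl p hp
  intro n
  induction n with
  | zero =>
    intro _ p hp
    have : p = 0 := by simpa [Nat.WithBot.lt_zero_iff] using hp
    simp [this, proj, coef, quad]
  | succ n ih =>
    intro hn p hp
    have hlc : (P n).coeff n ≠ 0 := by
      have := leadingCoeff_ne_zero.2 (P_ne_zero n)
      rwa [leadingCoeff, natDegree_P] at this
    set a := p.coeff n / (P n).coeff n with ha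
    have hq : (p - C a * P n).degree < n := by
      rw [degree_lt_iff_coeff_zero]
      intro j hj
      rw [coeff_sub, coeff_C_mul]
      rcases hj.lt_or_eq with h | h
      · rw [coeff_eq_zero_of_natDegree_lt (p := P n) (by rwa [natDegree_P]),
          coeff_eq_zero_of_degree_lt (hp.trans_le (by exact_mod_cast h))]
        simp
      · rw [← h, ha, div_mul_cancel₀ _ hlc, sub_self]
    have h1 : ∀ y, p.eval y • v = (p - C a * P n).eval y • v + (P n).eval y • a • v := by
      intro y
      rw [smul_smul, ← add_smul, eval_sub, eval_mul, eval_C]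
      congr 1
      ring
    have h2 : proj k s (fun c => (P n).eval c • a • v) x = (P n).eval x • a • v := by
      rw [proj, Finset.sum_eq_single_of_mem n (Finset.mem_range.2 hn)]
      · rw [coef_P_smul (Nat.lt_of_lt_of_le hn hsk) (Nat.lt_of_lt_of_le hn hsk), if_pos rfl,
          one_smul]
      · intro j hj hjn
        rw [coef_P_smul (Nat.lt_of_lt_of_le hn hsk) ((Finset.mem_range.1 hj).trans_le hsk),
          if_neg (Ne.symm hjn), zero_smul, smul_zero]
    simp only [h1]
    rw [proj_add, ih (Nat.le_of_succ_le hn) _ hq, h2]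

lemma proj_sum_pow {k s n : ℕ} (hsk : s ≤ k) (hn : n ≤ s) (b : ℕ → E) (x : ℝ) :
    proj k s (fun c => ∑ j ∈ Finset.range n, c ^ j • b j) x =
      ∑ j ∈ Finset.range n, x ^ j • b j := by
  rw [proj_sum]
  refine Finset.sum_congr rfl fun j hj => ?_
  have h := proj_eval_smul hsk (p := X ^ j) (E := E) (by
    rw [degree_X_pow]
    exact_mod_cast (Finset.mem_range.1 hj).trans_le hn) (b j) x
  simpa using h

/-- The error of the projection is orthogonal to the polynomials of degree less than `s`. -/
lemma quad_smul_sub_proj {k s : ℕ} (hsk : s ≤ k) {p : ℝ[X]} (hp : p.degree < s) (φ : ℝ → E) :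
    quad k (fun c => p.eval c • (φ c - proj k s φ c)) = 0 := by
  simp only [smul_sub]
  rw [quad_sub, sub_eq_zero]
  simp only [proj, Finset.smul_sum]
  rw [quad_sum]
  have h1 : ∀ j, quad k (fun c => p.eval c • (P j).eval c • coef k j φ) =
      coef k j (fun c => p.eval c) • coef k j φ := by
    intro j
    simp only [coef, quad, smul_smul, smul_eq_mul]
    rw [Finset.sum_smul]
    refine Finset.sum_congr rfl fun c _ => ?_
    congr 1
    ring
  have h2 : ∀ c, p.eval c = ∑ j ∈ Finset.range s, (P j).eval c * coef k j (fun c => p.eval c) := by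
    intro c
    simpa [proj] using (proj_eval_smul hsk hp (1 : ℝ) c).symm
  simp only [h1]
  calc quad k (fun c => p.eval c • φ c)
      = quad k (fun c => ∑ j ∈ Finset.range s,
          coef k j (fun c => p.eval c) • ((P j).eval c • φ c)) := by
        refine quad_congr fun c _ => ?_
        conv_lhs => rw [h2 c]
        rw [Finset.sum_smul]
        refine Finset.sum_congr rfl fun j _ => ?_
        rw [smul_smul, mul_comm]
    _ = ∑ j ∈ Finset.range s, coef k j (fun c => p.eval c) • coef k j φ := by
        rw [quad_sum]
        refine Finset.sum_congr rfl fun j _ => ?_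
        exact quad_map k (coef k j (fun c => p.eval c) • ContinuousLinearMap.id ℝ E) _

/-! ### Projection and quadrature errors for families of curves -/

variable {ι : Type v} {τ : ι → ℝ}

lemma mul_mem_Icc {a c : ℝ} (ha : 0 ≤ a) (hc : c ∈ Icc (0 : ℝ) 1) : c * a ∈ Icc 0 a :=
  ⟨mul_nonneg hc.1 ha, mul_le_of_le_one_left ha hc.2⟩

/-- The projection preserves uniform differentiability up to order `s`: it reproduces the Taylor
polynomial, and the remainder of order `n` contributes `P j (t / τ i)` with coefficients of order
`τ i ^ n`. For `n = s` these polynomials have degree less than `n`, so that all of their derivatives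
are bounded. -/
lemma UnifDiff.proj {k s n N : ℕ} (hsk : s ≤ k) (hτ : ∀ i, 0 < τ i) (hτ1 : ∀ i, τ i ≤ 1)
    (hn : n ≤ s) (hN : N ≤ n ∨ s ≤ n) {f : ι → ℝ → E} (hf : UnifDiff τ n f) :
    UnifDiff τ N fun i t => proj k s (fun c => f i (c * τ i)) (t / τ i) := by
  obtain ⟨C, hC0, hC⟩ := hf.taylor fun i => (hτ i).le
  choose a ha hR using hC
  choose D hD0 hD using fun j => exists_norm_coef_le (E := E) k j
  set R : ι → ℝ → E := fun i t => f i t - ∑ j ∈ Finset.range n, t ^ j • a i j with hRdef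
  have h1 : UnifDiff τ N fun i t =>
      ∑ j ∈ Finset.range n, (X ^ j : ℝ[X]).eval (t / τ i) • τ i ^ j • a i j := by
    refine UnifDiff.sum _ fun j _ => UnifDiff.eval_smul hτ hτ1 (n := j) (C := C)
      (Or.inl (natDegree_X_pow_le j)) fun i => ?_
    rw [norm_smul, norm_pow, Real.norm_of_nonneg (hτ i).le, mul_comm]
    exact mul_le_mul_of_nonneg_right (ha i j) (pow_nonneg (hτ i).le j)
  have h2 : UnifDiff τ N fun i t => ∑ j ∈ Finset.range s, (P j).eval (t / τ i) •
      coef k j (fun c => R i (c * τ i)) := by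
    refine UnifDiff.sum _ fun j hj => UnifDiff.eval_smul hτ hτ1 (n := n) (C := D j * C)
      ?_ fun i => ?_
    · rw [natDegree_P]
      have := Finset.mem_range.1 hj
      omega
    · rw [mul_assoc]
      exact hD j _ _ (mul_nonneg hC0 (pow_nonneg (hτ i).le n))
        fun c hc => hR i _ (mul_mem_Icc (hτ i).le (mem_Icc_of_mem_nodes hc))
  refine (h1.add h2).congr fun i t _ => ?_
  have h3 : ∀ c, f i (c * τ i) =
      (∑ j ∈ Finset.range n, c ^ j • τ i ^ j • a i j) + R i (c * τ i) := by
    intro c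
    rw [hRdef]
    simp only [mul_pow, smul_smul, add_sub_cancel]
  simp only [h3]
  rw [proj_add, proj_sum_pow hsk hn]
  simp [PHBVM.proj]

lemma UnifDiff.norm_sub_proj_le {k s : ℕ} (hsk : s ≤ k) (hτ : ∀ i, 0 ≤ τ i)
    {f : ι → ℝ → E} (hf : UnifDiff τ s f) :
    ∃ C, 0 ≤ C ∧ ∀ i, ∀ x ∈ Icc (0 : ℝ) 1,
      ‖f i (x * τ i) - PHBVM.proj k s (fun c => f i (c * τ i)) x‖ ≤ C * τ i ^ s := by
  obtain ⟨C, hC0, hC⟩ := hf.taylor hτ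
  obtain ⟨D, hD0, hD⟩ := exists_norm_proj_le (E := E) k s
  refine ⟨C + D * C, by positivity, fun i x hx => ?_⟩
  obtain ⟨a, -, hR⟩ := hC i
  set R : ℝ → E := fun t => f i t - ∑ j ∈ Finset.range s, t ^ j • a j with hRdef
  have h3 : ∀ c, f i (c * τ i) =
      (∑ j ∈ Finset.range s, c ^ j • τ i ^ j • a j) + R (c * τ i) := by
    intro c
    rw [hRdef]
    simp only [mul_pow, smul_smul, add_sub_cancel]
  simp only [h3]
  rw [proj_add, proj_sum_pow hsk le_rfl, add_sub_add_left_eq_sub, add_mul, mul_assoc]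
  exact (norm_sub_le _ _).trans (add_le_add (hR _ (mul_mem_Icc (hτ i) hx))
    (hD _ _ (mul_nonneg hC0 (pow_nonneg (hτ i) s))
      (fun c hc => hR _ (mul_mem_Icc (hτ i) (mem_Icc_of_mem_nodes hc))) x hx))

/-- The order doubles: the projection error of `g` is of order `s`, and it annihilates the Taylor
polynomial of `f`, whose remainder is of order `s` as well. -/
lemma UnifDiff.norm_quad_sub_proj_le {k s : ℕ} (hsk : s ≤ k) (hτ : ∀ i, 0 ≤ τ i)
    {f : ι → ℝ → E →L[ℝ] F} {g : ι → ℝ → E} (hf : UnifDiff τ s f) (hg : UnifDiff τ s g) :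
    ∃ C, 0 ≤ C ∧ ∀ i, ‖quad k (fun x => f i (x * τ i)
      (g i (x * τ i) - PHBVM.proj k s (fun c => g i (c * τ i)) x))‖ ≤ C * τ i ^ (2 * s) := by
  obtain ⟨C, hC0, hC⟩ := hf.taylor hτ
  obtain ⟨D, hD0, hD⟩ := hg.norm_sub_proj_le hsk hτ
  have hW : 0 ≤ ∑ c ∈ nodes k, |weight k c| := Finset.sum_nonneg fun _ _ => abs_nonneg _
  refine ⟨(∑ c ∈ nodes k, |weight k c|) * (C * D), by positivity, fun i => ?_⟩
  obtain ⟨a, -, hR⟩ := hC i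
  set δ : ℝ → E := fun x => g i (x * τ i) - PHBVM.proj k s (fun c => g i (c * τ i)) x with hδ
  have h1 : ∀ x, f i (x * τ i) (δ x) = (∑ j ∈ Finset.range s, (τ i ^ j • a j) (x ^ j • δ x)) +
      (f i (x * τ i) - ∑ j ∈ Finset.range s, (x * τ i) ^ j • a j) (δ x) := by
    intro x
    simp only [sub_apply, sum_apply, smul_apply, map_smul, smul_smul, mul_pow, add_sub_cancel]
  have h2 : quad k (fun x => ∑ j ∈ Finset.range s, (τ i ^ j • a j) (x ^ j • δ x)) = 0 := by
    rw [quad_sum]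
    refine Finset.sum_eq_zero fun j hj => ?_
    rw [quad_map]
    have h := quad_smul_sub_proj hsk (p := X ^ j) (by
      rw [degree_X_pow]
      exact_mod_cast Finset.mem_range.1 hj) fun c => g i (c * τ i)
    simp only [eval_pow, eval_X] at h
    rw [h, map_zero]
  change ‖quad k (fun x => f i (x * τ i) (δ x))‖ ≤ _
  rw [quad_congr fun x _ => h1 x, quad_add, h2, zero_add, mul_assoc]
  refine norm_quad_le fun c hc => ?_
  have hc' := mem_Icc_of_mem_nodes hc
  refine (ContinuousLinearMap.le_opNorm _ _).trans ?_
  rw [two_mul, pow_add, mul_mul_mul_comm]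
  exact mul_le_mul (hR _ (mul_mem_Icc (hτ i) hc')) (hD i c hc') (norm_nonneg _)
    (mul_nonneg hC0 (pow_nonneg (hτ i) s))

/-- Quadrature error for the increment of `f`, when the derivative of `f` is close to `g`. -/
lemma UnifDiff.norm_sub_quad_le {k n : ℕ} (hn : n ≤ 2 * k) (hτ : ∀ i, 0 ≤ τ i)
    {f f' g : ι → ℝ → E} (hg : UnifDiff τ n g) {B : ℝ}
    (hgf : ∀ i, ∀ t ∈ Icc 0 (τ i), ‖f' i t - g i t‖ ≤ B * τ i ^ n)
    (hd : ∀ i, ∀ t ∈ Icc 0 (τ i), HasDerivWithinAt (f i) (f' i t) (Icc 0 (τ i)) t) :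
    ∃ C, ∀ i, ‖f i (τ i) - f i 0 - τ i • quad k (fun c => g i (c * τ i))‖ ≤
      C * τ i ^ (n + 1) := by
  obtain ⟨C, hC0, hC⟩ := hg.taylor hτ
  refine ⟨B + C + (∑ c ∈ nodes k, |weight k c|) * C, fun i => ?_⟩
  obtain ⟨a, -, hR⟩ := hC i
  have hR' : ∀ t ∈ Icc 0 (τ i), ‖f' i t - ∑ j ∈ Finset.range n, t ^ j • a j‖ ≤
      (B + C) * τ i ^ n := by
    intro t ht
    rw [← sub_add_sub_cancel _ (g i t), add_mul]
    exact (norm_add_le _ _).trans (add_le_add (hgf i t ht) (hR t ht))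
  have hderiv : ∀ x ∈ Icc 0 (τ i), HasDerivWithinAt
      (fun x => f i x - ∑ j ∈ Finset.range n, x ^ (j + 1) • ((j : ℝ) + 1)⁻¹ • a j)
      (f' i x - ∑ j ∈ Finset.range n, x ^ j • a j) (Icc 0 (τ i)) x := by
    intro x hx
    refine (hd i x hx).sub (HasDerivWithinAt.fun_sum fun j _ => ?_)
    refine (((hasDerivAt_pow (j + 1) x).smul_const _).hasDerivWithinAt).congr_deriv ?_
    rw [smul_smul]
    congr 1
    push_cast
    field_simp
  have h1 := norm_image_sub_le_of_norm_deriv_le_segment' hderiv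
    (fun x hx => hR' x (Ico_subset_Icc_self hx)) (τ i) ⟨hτ i, le_rfl⟩
  simp only [ne_eq, Nat.add_eq_zero_iff, one_ne_zero, and_false, not_false_eq_true, zero_pow,
    zero_smul, Finset.sum_const_zero, sub_zero] at h1
  have h2 := norm_quad_le (k := k) fun c hc =>
    hR (c * τ i) (mul_mem_Icc (hτ i) (mem_Icc_of_mem_nodes hc))
  have h3 : τ i • quad k (fun c => ∑ j ∈ Finset.range n, (c * τ i) ^ j • a j) =
      ∑ j ∈ Finset.range n, τ i ^ (j + 1) • ((j : ℝ) + 1)⁻¹ • a j := by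
    rw [quad_sum, Finset.smul_sum]
    refine Finset.sum_congr rfl fun j hj => ?_
    have hj' : (X ^ j : ℝ[X]).natDegree < 2 * k := by
      rw [natDegree_X_pow]
      have := Finset.mem_range.1 hj
      omega
    have h := quad_eval_smul hj' (τ i ^ j • a j)
    rw [integral_eval_X_pow] at h
    simp only [eval_pow, eval_X, smul_smul, ← mul_pow] at h
    rw [h, smul_smul, smul_smul]
    congr 1
    rw [pow_succ]
    ring
  rw [quad_sub] at h2
  have h4 : f i (τ i) - f i 0 - τ i • quad k (fun c => g i (c * τ i)) =
      (f i (τ i) - (∑ j ∈ Finset.range n, τ i ^ (j + 1) • ((j : ℝ) + 1)⁻¹ • a j) - f i 0) -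
      τ i • (quad k (fun c => g i (c * τ i)) -
        quad k (fun c => ∑ j ∈ Finset.range n, (c * τ i) ^ j • a j)) := by
    rw [smul_sub, h3]
    abel
  rw [h4]
  have h5 : ‖τ i • (quad k (fun c => g i (c * τ i)) -
      quad k (fun c => ∑ j ∈ Finset.range n, (c * τ i) ^ j • a j))‖ ≤
      τ i * ((∑ c ∈ nodes k, |weight k c|) * (C * τ i ^ n)) := by
    rw [norm_smul, Real.norm_of_nonneg (hτ i)]
    exact mul_le_mul_of_nonneg_left h2 (hτ i)
  refine (norm_sub_le _ _).trans ((add_le_add h1 h5).trans_eq ?_)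
  ring

end Projection

/-! ### Regularity of the numerical solution -/

section Path

universe u v

variable {E : Type u} [NormedAddCommGroup E] [NormedSpace ℝ E]

/-- The function `A(φ) ∑ⱼ Pⱼ γ̂ⱼ`, whose projection is the velocity of the method: `A` stands for
the structure matrix, `g` for the gradient and `φ` for the path, rescaled to the unit interval. -/
noncomputable def field (k s : ℕ) (A : E → E →L[ℝ] E) (g : E → E) (φ : ℝ → E) (c : ℝ) : E :=
  A (φ c) (proj k s (fun x => g (φ x)) c)

/-- The increment of the method on the unit interval: the primitive, vanishing at `0`, of the
projection of `field k s A g φ`. -/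
noncomputable def incr (k s : ℕ) (A : E → E →L[ℝ] E) (g : E → E) (φ : ℝ → E) (c : ℝ) : E :=
  ∑ i ∈ Finset.range s, (∫ x in (0 : ℝ)..c, (P i).eval x) • coef k i (field k s A g φ)

lemma hasDerivAt_incr (k s : ℕ) (A : E → E →L[ℝ] E) (g : E → E) (φ : ℝ → E) (c : ℝ) :
    HasDerivAt (incr k s A g φ) (proj k s (field k s A g φ) c) c := by
  refine HasDerivAt.fun_sum fun i _ => HasDerivAt.smul_const ?_ _
  exact intervalIntegral.integral_hasDerivAt_right (intervalIntegrable_eval _ _ _)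
    ((P i).continuous.stronglyMeasurableAtFilter _ _) (P i).continuous.continuousAt

lemma incr_zero (k s : ℕ) (A : E → E →L[ℝ] E) (g : E → E) (φ : ℝ → E) :
    incr k s A g φ 0 = 0 := by
  simp [incr]

variable {ι : Type v} {τ : ι → ℝ} {k s : ℕ} {A : E → E →L[ℝ] E} {g : E → E} {y₀ : E}
  {u : ι → ℝ → E}

lemma hasDerivAt_of_path {h : ℝ} (hh : 0 < h) {w : ℝ → E}
    (hw : ∀ c, w (c * h) = y₀ + h • incr k s A g (fun x => w (x * h)) c) (t : ℝ) :
    HasDerivAt w (proj k s (field k s A g fun x => w (x * h)) (t / h)) t := by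
  have h1 : w = fun t => y₀ + h • incr k s A g (fun x => w (x * h)) (t / h) := by
    funext t
    rw [← hw, div_mul_cancel₀ _ hh.ne']
  have h2 := (((hasDerivAt_incr k s A g (fun x => w (x * h)) (t / h)).scomp t
    ((hasDerivAt_id t).div_const h)).const_smul h).const_add y₀
  refine (h2.congr_deriv ?_).congr_of_eventuallyEq (Filter.Eventually.of_forall (congrFun h1))
  rw [smul_smul, mul_one_div_cancel hh.ne', one_smul]

variable {U D : Set E}

/-- The function `field` along the paths, as a family of curves on `[0, τ i]`. -/
lemma UnifDiff.field (hsk : s ≤ k) (hτ : ∀ i, 0 < τ i) (hτ1 : ∀ i, τ i ≤ 1)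
    (hU : IsOpen U) (hD : IsCompact D) (hDU : D ⊆ U) {n : ℕ} (hn : n ≤ s)
    (hA : ContDiffOn ℝ n A U) (hg : ContDiffOn ℝ n g U)
    (huD : ∀ i, ∀ t ∈ Icc 0 (τ i), u i t ∈ D) (hu : UnifDiff τ n u) :
    UnifDiff τ n fun i t => field k s A g (fun x => u i (x * τ i)) (t / τ i) := by
  have h1 := (UnifDiff.comp hU hD hDU hg hu huD).proj hsk hτ hτ1 hn (Or.inl le_rfl)
  refine ((UnifDiff.comp hU hD hDU hA hu huD).apply h1).congr fun i t _ => ?_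
  simp only [PHBVM.field, div_mul_cancel₀ _ (hτ i).ne']

/-- Bootstrapping: a bound on `n` derivatives of the paths bounds `n` derivatives of their velocity.
As the velocity has degree less than `s`, all derivatives are bounded once `n = s`. -/
lemma unifDiff_path (hsk : s ≤ k) (hτ : ∀ i, 0 < τ i) (hτ1 : ∀ i, τ i ≤ 1)
    (hU : IsOpen U) (hD : IsCompact D) (hDU : D ⊆ U)
    (hA : ContDiffOn ℝ s A U) (hg : ContDiffOn ℝ s g U)
    (huD : ∀ i, ∀ t ∈ Icc 0 (τ i), u i t ∈ D)
    (hu : ∀ i c, u i (c * τ i) = y₀ + τ i • incr k s A g (fun x => u i (x * τ i)) c) (N : ℕ) :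
    UnifDiff τ N u := by
  have h0 : UnifDiff τ 0 u := by
    obtain ⟨C, hC⟩ := hD.exists_bound_of_continuousOn (f := id) continuousOn_id
    exact ⟨C, fun i t ht => hC _ (huD i t ht)⟩
  have hstep : ∀ n ≤ s, ∀ N, (N ≤ n ∨ s ≤ n) → UnifDiff τ n u → UnifDiff τ (N + 1) u := by
    intro n hn N hN hun
    have hns : (n : WithTop ℕ∞) ≤ s := by exact_mod_cast hn
    have h1 := (UnifDiff.field hsk hτ hτ1 hU hD hDU hn (hA.of_le hns) (hg.of_le hns)
      huD hun).proj hsk hτ hτ1 hn hN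
    refine h0.succ_intro h1 fun i t _ => ?_
    have h2 := (hasDerivAt_of_path (hτ i) (hu i) t).hasDerivWithinAt (s := Icc 0 (τ i))
    refine h2.congr_deriv ?_
    simp only [mul_div_cancel_right₀ _ (hτ i).ne']
  have hs : ∀ n ≤ s, UnifDiff τ n u := by
    intro n
    induction n with
    | zero => exact fun _ => h0
    | succ n ih =>
      exact fun hn =>
        hstep n (Nat.le_of_succ_le hn) n (Or.inl le_rfl) (ih (Nat.le_of_succ_le hn))
  exact (hstep s le_rfl N (Or.inr le_rfl) (hs s le_rfl)).of_succ

/-! ### Residual of the numerical solution -/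

/-- The residual of the path `w` in the differential equation `y' = A(y) g(y)`. -/
noncomputable def resid (k s : ℕ) (A : E → E →L[ℝ] E) (g : E → E) (h : ℝ) (w : ℝ → E) (t : ℝ) : E :=
  proj k s (field k s A g fun x => w (x * h)) (t / h) - A (w t) (g (w t))

lemma resid_mul {h : ℝ} (hh : 0 < h) (w : ℝ → E) (x : ℝ) :
    resid k s A g h w (x * h) =
      -(field k s A g (fun c => w (c * h)) x - proj k s (field k s A g fun c => w (c * h)) x) -
      A (w (x * h)) (g (w (x * h)) - proj k s (fun c => g (w (c * h))) x) := by
  rw [resid, mul_div_cancel_right₀ _ hh.ne', map_sub]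
  simp only [field]
  abel

lemma norm_resid_le (hsk : s ≤ k) (hτ : ∀ i, 0 < τ i) (hτ1 : ∀ i, τ i ≤ 1)
    (hU : IsOpen U) (hD : IsCompact D) (hDU : D ⊆ U)
    (hA : ContDiffOn ℝ s A U) (hg : ContDiffOn ℝ s g U)
    (huD : ∀ i, ∀ t ∈ Icc 0 (τ i), u i t ∈ D) (hu : UnifDiff τ s u) :
    ∃ C, 0 ≤ C ∧ ∀ i, ∀ t ∈ Icc 0 (τ i), ‖resid k s A g (τ i) (u i) t‖ ≤ C * τ i ^ s := by
  obtain ⟨C₁, hC₁, h₁⟩ := (UnifDiff.field hsk hτ hτ1 hU hD hDU le_rfl hA hg huD hu).norm_sub_proj_le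
    hsk fun i => (hτ i).le
  obtain ⟨C₂, hC₂, h₂⟩ := (UnifDiff.comp hU hD hDU hg hu huD).norm_sub_proj_le
    hsk fun i => (hτ i).le
  obtain ⟨M, hM, h₃⟩ := (UnifDiff.comp hU hD hDU hA hu huD).bound
  refine ⟨C₁ + M * C₂, by positivity, fun i t ht => ?_⟩
  have hx : t / τ i ∈ Icc (0 : ℝ) 1 :=
    ⟨div_nonneg ht.1 (hτ i).le, div_le_one_of_le₀ ht.2 (hτ i).le⟩
  have hxt : t / τ i * τ i = t := div_mul_cancel₀ _ (hτ i).ne'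
  have h₁' := h₁ i _ hx
  simp only [mul_div_cancel_right₀ _ (hτ i).ne'] at h₁'
  have h₂' := h₂ i _ hx
  have h₄ := resid_mul (k := k) (s := s) (A := A) (g := g) (hτ i) (u i) (t / τ i)
  rw [hxt] at h₂' h₄
  rw [h₄, add_mul, mul_assoc]
  refine (norm_sub_le _ _).trans (add_le_add (by rwa [norm_neg]) ?_)
  refine (ContinuousLinearMap.le_opNorm _ _).trans ?_
  exact mul_le_mul (h₃ i t ht) h₂' (norm_nonneg _) hM

/-- Tested against a smooth family of linear maps, the residual is of order `2 s`. -/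
lemma norm_quad_resid_le (hsk : s ≤ k) (hτ : ∀ i, 0 < τ i) (hτ1 : ∀ i, τ i ≤ 1)
    (hU : IsOpen U) (hD : IsCompact D) (hDU : D ⊆ U)
    (hA : ContDiffOn ℝ s A U) (hg : ContDiffOn ℝ s g U)
    (huD : ∀ i, ∀ t ∈ Icc 0 (τ i), u i t ∈ D) (hu : UnifDiff τ s u)
    {ψ : ι → ℝ → E →L[ℝ] E} (hψ : UnifDiff τ s ψ) :
    ∃ C, 0 ≤ C ∧ ∀ i, ‖quad k (fun c => ψ i (c * τ i)
      (resid k s A g (τ i) (u i) (c * τ i)))‖ ≤ C * τ i ^ (2 * s) := by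
  have hψA : UnifDiff τ s fun i t => (ψ i t).comp (A (u i t)) :=
    UnifDiff.bilin (ContinuousLinearMap.compL ℝ E E E) hψ (UnifDiff.comp hU hD hDU hA hu huD)
  obtain ⟨C₁, hC₁, h₁⟩ := hψ.norm_quad_sub_proj_le hsk (fun i => (hτ i).le)
    (UnifDiff.field hsk hτ hτ1 hU hD hDU le_rfl hA hg huD hu)
  obtain ⟨C₂, hC₂, h₂⟩ := hψA.norm_quad_sub_proj_le hsk (fun i => (hτ i).le)
    (UnifDiff.comp hU hD hDU hg hu huD)
  refine ⟨C₁ + C₂, by positivity, fun i => ?_⟩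
  have h₁' := h₁ i
  simp only [mul_div_cancel_right₀ _ (hτ i).ne'] at h₁'
  have h : quad k (fun c => ψ i (c * τ i) (resid k s A g (τ i) (u i) (c * τ i))) =
      -quad k (fun x => ψ i (x * τ i) (field k s A g (fun c => u i (c * τ i)) x -
        proj k s (field k s A g fun c => u i (c * τ i)) x)) -
      quad k (fun x => (ψ i (x * τ i)).comp (A (u i (x * τ i)))
        (g (u i (x * τ i)) - proj k s (fun c => g (u i (c * τ i))) x)) := by
    rw [← quad_neg, ← quad_sub]
    refine quad_congr fun c _ => ?_
    rw [resid_mul (hτ i), map_sub, map_neg]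
    rfl
  rw [h, add_mul]
  exact (norm_sub_le _ _).trans (add_le_add (by rw [norm_neg]; exact h₁') (h₂ i))

end Path

/-! ### The linearized equation -/

section Convergence

universe u v

variable {E : Type u} [NormedAddCommGroup E] [NormedSpace ℝ E]

/-- Short-time existence for the adjoint `Ψ' = -Ψ Λ` of the linear equation `e' = Λ e`. -/
lemma exists_adjoint_solution [CompleteSpace E] {T : ℝ} (hT : 0 < T) {Λ : ℝ → E →L[ℝ] E}
    (hΛ : ContinuousOn Λ (Icc 0 T)) :
    ∃ δ, 0 < δ ∧ δ ≤ T ∧ ∃ Ψ : ℝ → E →L[ℝ] E,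
      (∀ t ∈ Icc 0 δ, HasDerivWithinAt Ψ (-(Ψ t).comp (Λ t)) (Icc 0 δ) t) ∧
      ∀ t ∈ Icc 0 δ, ‖Ψ t - ContinuousLinearMap.id ℝ E‖ ≤ 1 / 2 := by
  obtain ⟨M, hM⟩ := isCompact_Icc.exists_bound_of_continuousOn hΛ
  have hM0 : 0 ≤ M := (norm_nonneg _).trans (hM 0 ⟨le_rfl, hT.le⟩)
  -- In the ball of radius `1` around the identity the vector field is bounded by `2 M`, so that
  -- solutions stay in this ball up to time `1 / (2 M)`.
  set δ₁ := min T (1 / (2 * M + 1)) with hδ₁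
  have hδ₁0 : 0 < δ₁ := by positivity
  have hδ₁T : δ₁ ≤ T := min_le_left _ _
  have hPL : IsPicardLindelof (fun t X => -(X : E →L[ℝ] E).comp (Λ t))
      (tmin := 0) (tmax := δ₁) ⟨0, le_rfl, hδ₁0.le⟩ (ContinuousLinearMap.id ℝ E) 1 0
      ⟨2 * M, by positivity⟩ ⟨M, hM0⟩ := by
    refine ⟨fun t ht => ?_, fun X _ => ?_, fun t ht X hX => ?_, ?_⟩
    · refine LipschitzOnWith.of_dist_le_mul fun X _ Y _ => ?_
      rw [dist_eq_norm, dist_eq_norm, neg_sub_neg, ← ContinuousLinearMap.sub_comp, norm_sub_rev X,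
        mul_comm]
      refine (ContinuousLinearMap.opNorm_comp_le _ _).trans ?_
      exact mul_le_mul_of_nonneg_left (hM t ⟨ht.1, ht.2.trans hδ₁T⟩) (norm_nonneg _)
    · exact ((ContinuousLinearMap.compL ℝ E E E X).continuous.comp_continuousOn
        (hΛ.mono (Icc_subset_Icc_right hδ₁T))).neg
    · rw [norm_neg]
      refine (ContinuousLinearMap.opNorm_comp_le _ _).trans ?_
      have h1 : ‖X‖ ≤ 2 := by
        rw [mem_closedBall_iff_norm] at hX
        have h2 := norm_le_norm_add_norm_sub' X (ContinuousLinearMap.id ℝ E)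
        have h3 : ‖ContinuousLinearMap.id ℝ E‖ ≤ 1 := ContinuousLinearMap.norm_id_le
        have h4 : ‖X - ContinuousLinearMap.id ℝ E‖ ≤ 1 := by simpa using hX
        linarith
      exact mul_le_mul h1 (hM t ⟨ht.1, ht.2.trans hδ₁T⟩) (norm_nonneg _) zero_le_two
    · have h1 : 2 * M * δ₁ ≤ 1 := by
        have h2 : δ₁ * (2 * M + 1) ≤ 1 := by
          rw [← le_div_iff₀ (by positivity)]
          exact min_le_right _ _
        nlinarith
      change 2 * M * max (δ₁ - 0) (0 - 0) ≤ ((1 : NNReal) : ℝ) - ((0 : NNReal) : ℝ)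
      simpa [hδ₁0.le] using h1
  obtain ⟨Ψ, hΨ0, hΨ⟩ := hPL.exists_eq_forall_mem_Icc_hasDerivWithinAt₀
  have hc : ContinuousWithinAt Ψ (Icc 0 δ₁) 0 := (hΨ 0 ⟨le_rfl, hδ₁0.le⟩).continuousWithinAt
  obtain ⟨ε, hε, hεΨ⟩ := Metric.continuousWithinAt_iff.1 hc (1 / 2) (by norm_num)
  refine ⟨min δ₁ (ε / 2), by positivity, (min_le_left _ _).trans hδ₁T, Ψ, fun t ht => ?_,
    fun t ht => ?_⟩
  · exact (hΨ t ⟨ht.1, ht.2.trans (min_le_left _ _)⟩).mono (Icc_subset_Icc_right (min_le_left _ _))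
  · have h1 := hεΨ (x := t) ⟨ht.1, ht.2.trans (min_le_left _ _)⟩ (by
      rw [Real.dist_eq, sub_zero, abs_of_nonneg ht.1]
      linarith [ht.2.trans (min_le_right _ _)])
    rw [show Ψ 0 = ContinuousLinearMap.id ℝ E from hΨ0, dist_eq_norm] at h1
    exact h1.le

lemma exists_lipschitz_bound {U D : Set E} (hU : IsOpen U) (hD : IsCompact D) (hDc : Convex ℝ D)
    (hDU : D ⊆ U) {F : Type u} [NormedAddCommGroup F] [NormedSpace ℝ F] {f : E → F}
    (hf : ContDiffOn ℝ 1 f U) :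
    ∃ L, 0 ≤ L ∧ ∀ a ∈ D, ∀ b ∈ D, ‖f a - f b‖ ≤ L * ‖a - b‖ := by
  have hf' : ContDiffOn ℝ 0 (fderiv ℝ f) U := hf.fderiv_of_isOpen hU (by simp)
  obtain ⟨L, hL⟩ := hD.exists_bound_of_continuousOn (hf'.continuousOn.mono hDU)
  refine ⟨max L 0, le_max_right _ _, fun a ha b hb => ?_⟩
  refine hDc.norm_image_sub_le_of_norm_hasFDerivWithin_le (f' := fderiv ℝ f) (fun x hx => ?_)
    (fun x hx => (hL x hx).trans (le_max_left _ _)) hb ha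
  exact ((hf.differentiableOn one_ne_zero).differentiableAt
    (hU.mem_nhds (hDU hx))).hasFDerivAt.hasFDerivWithinAt

lemma exists_linearization_bound {U D : Set E} (hU : IsOpen U) (hD : IsCompact D)
    (hDc : Convex ℝ D) (hDU : D ⊆ U) {F : Type u} [NormedAddCommGroup F] [NormedSpace ℝ F]
    {f : E → F} (hf : ContDiffOn ℝ 2 f U) :
    ∃ L, 0 ≤ L ∧ ∀ a ∈ D, ∀ b ∈ D, ‖f a - f b - fderiv ℝ f b (a - b)‖ ≤ L * ‖a - b‖ ^ 2 := by
  have hf' : ContDiffOn ℝ 1 (fderiv ℝ f) U := hf.fderiv_of_isOpen hU (by norm_num)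
  obtain ⟨L, hL0, hL⟩ := exists_lipschitz_bound hU hD hDc hDU hf'
  refine ⟨L, hL0, fun a ha b hb => ?_⟩
  have hs : segment ℝ b a ⊆ D := hDc.segment_subset hb ha
  have h := (convex_segment b a).norm_image_sub_le_of_norm_hasFDerivWithin_le'
    (f := f) (f' := fderiv ℝ f) (φ := fderiv ℝ f b) (C := L * ‖a - b‖) (fun x hx => ?_)
    (fun x hx => (hL x (hs hx) b hb).trans ?_) (left_mem_segment ℝ b a) (right_mem_segment ℝ b a)
  · rwa [mul_assoc, ← sq] at h
  · exact ((hf.differentiableOn two_ne_zero).differentiableAt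
      (hU.mem_nhds (hDU (hs hx)))).hasFDerivAt.hasFDerivWithinAt
  · refine mul_le_mul_of_nonneg_left ?_ hL0
    have hball := (convex_closedBall b ‖a - b‖).segment_subset
      (Metric.mem_closedBall_self (norm_nonneg _)) (mem_closedBall_iff_norm.2 le_rfl)
    exact mem_closedBall_iff_norm.1 (hball hx)

/-! ### Order of convergence -/

/-- A Gronwall estimate for short times: the maximum of `‖e‖` over `[0, h]` is at most `h` times the
bound that it implies for `‖e'‖`. -/
lemma norm_error_le {h L c : ℝ} (hh : 0 ≤ h) (hL : h * L ≤ 1 / 2) {e e' : ℝ → E}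
    (hd : ∀ t ∈ Icc 0 h, HasDerivWithinAt e (e' t) (Icc 0 h) t) (h0 : e 0 = 0)
    (hb : ∀ t ∈ Icc 0 h, ‖e' t‖ ≤ L * ‖e t‖ + c) (hL0 : 0 ≤ L) :
    ∀ t ∈ Icc 0 h, ‖e t‖ ≤ 2 * h * c := by
  have hc : ContinuousOn (fun t => ‖e t‖) (Icc 0 h) := fun t ht =>
    (hd t ht).continuousWithinAt.norm
  obtain ⟨m, hm, hmax⟩ := isCompact_Icc.exists_isMaxOn (nonempty_Icc.2 hh) hc
  have h1 := norm_image_sub_le_of_norm_deriv_le_segment' (C := L * ‖e m‖ + c) hd (fun t ht =>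
    (hb t (Ico_subset_Icc_self ht)).trans (add_le_add_left (mul_le_mul_of_nonneg_left
      (hmax (Ico_subset_Icc_self ht)) hL0) c)) m hm
  rw [h0, sub_zero, sub_zero] at h1
  have hnn : 0 ≤ L * ‖e m‖ + c := (norm_nonneg _).trans (hb m hm)
  have h2 : ‖e m‖ ≤ (L * ‖e m‖ + c) * h := h1.trans (mul_le_mul_of_nonneg_left hm.2 hnn)
  have h3 : h * L * ‖e m‖ ≤ 1 / 2 * ‖e m‖ := mul_le_mul_of_nonneg_right hL (norm_nonneg _)
  intro t ht
  have h4 : ‖e t‖ ≤ ‖e m‖ := hmax ht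
  nlinarith

variable {ι : Type v} {τ : ι → ℝ} {k s : ℕ} {A : E → E →L[ℝ] E} {g : E → E}
  {u : ι → ℝ → E} {U D : Set E} {y : ℝ → E} {δ : ℝ}

/-- The family of the restrictions of one and the same solution to the intervals `[0, τ i]`. -/
lemma unifDiff_solution {n : ℕ} (hU : IsOpen U) (hD : IsCompact D) (hDU : D ⊆ U) {f : E → E}
    (hf : ContDiffOn ℝ n f U) (hτδ : ∀ i, τ i ≤ δ) (hyD : ∀ t ∈ Icc 0 δ, y t ∈ D)
    (hy : ∀ t ∈ Icc 0 δ, HasDerivWithinAt y (f (y t)) (Icc 0 δ) t) :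
    UnifDiff τ (n + 1) fun _ => y := by
  have hsub : ∀ i, Icc 0 (τ i) ⊆ Icc 0 δ := fun i => Icc_subset_Icc_right (hτδ i)
  have h0 : UnifDiff τ 0 fun _ => y := by
    obtain ⟨C, hC⟩ := hD.exists_bound_of_continuousOn (f := id) continuousOn_id
    exact ⟨C, fun i t ht => hC _ (hyD t (hsub i ht))⟩
  have key : ∀ m ≤ n + 1, UnifDiff τ m fun _ => y := by
    intro m
    induction m with
    | zero => exact fun _ => h0
    | succ m ih =>
      intro hm
      have hmn : (m : WithTop ℕ∞) ≤ n := by exact_mod_cast Nat.le_of_succ_le_succ hm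
      exact h0.succ_intro (UnifDiff.comp hU hD hDU (hf.of_le hmn) (ih (Nat.le_of_succ_le hm))
        fun i t ht => hyD t (hsub i ht)) fun i t ht => (hy t (hsub i ht)).mono (hsub i)
  exact key _ le_rfl

/-- The linear equation gives `Ψ` one derivative more than `Λ`. -/
lemma unifDiff_adjoint {n : ℕ} {Ψ Λ : ℝ → E →L[ℝ] E} (hτδ : ∀ i, τ i ≤ δ)
    (hΨ : ∀ t ∈ Icc 0 δ, HasDerivWithinAt Ψ (-(Ψ t).comp (Λ t)) (Icc 0 δ) t)
    (hΛ : UnifDiff τ n fun _ => Λ) : UnifDiff τ (n + 1) fun _ => Ψ := by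
  have hsub : ∀ i, Icc 0 (τ i) ⊆ Icc 0 δ := fun i => Icc_subset_Icc_right (hτδ i)
  have h0 : UnifDiff τ 0 fun _ => Ψ := by
    obtain ⟨C, hC⟩ := isCompact_Icc.exists_bound_of_continuousOn fun t ht =>
      (hΨ t ht).continuousWithinAt
    exact ⟨C, fun i t ht => hC t (hsub i ht)⟩
  have key : ∀ m ≤ n + 1, UnifDiff τ m fun _ => Ψ := by
    intro m
    induction m with
    | zero => exact fun _ => h0
    | succ m ih =>
      intro hm
      exact h0.succ_intro (UnifDiff.bilin (ContinuousLinearMap.compL ℝ E E E)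
        (ih (Nat.le_of_succ_le hm)) (hΛ.mono (Nat.le_of_succ_le_succ hm))).neg
        fun i t ht => (hΨ t (hsub i ht)).mono (hsub i)
  exact key _ le_rfl

/-- With `e = u - y`, the derivative of `Ψ e` is `Ψ` applied to the residual, up to an error of
order `2 s + 2`; the quadrature rule then shows that `Ψ e` is of order `2 s + 1` at the end of the
step. -/
lemma norm_sub_solution_le (hs : 1 ≤ s) (hsk : s ≤ k) (hτ : ∀ i, 0 < τ i) (hτ1 : ∀ i, τ i ≤ 1)
    (hτδ : ∀ i, τ i ≤ δ) (hU : IsOpen U) (hD : IsCompact D) (hDc : Convex ℝ D) (hDU : D ⊆ U)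
    (hA : ContDiffOn ℝ (2 * s : ℕ) A U) (hg : ContDiffOn ℝ (2 * s : ℕ) g U)
    (huD : ∀ i, ∀ t ∈ Icc 0 (τ i), u i t ∈ D)
    (hu : ∀ i c, u i (c * τ i) = y 0 + τ i • incr k s A g (fun x => u i (x * τ i)) c)
    (hyD : ∀ t ∈ Icc 0 δ, y t ∈ D)
    (hy : ∀ t ∈ Icc 0 δ, HasDerivWithinAt y (A (y t) (g (y t))) (Icc 0 δ) t)
    {L : ℝ} (hL0 : 0 ≤ L) (hL : ∀ a ∈ D, ∀ b ∈ D, ‖A a (g a) - A b (g b)‖ ≤ L * ‖a - b‖)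
    (hLτ : ∀ i, τ i * L ≤ 1 / 2) {Ψ : ℝ → E →L[ℝ] E}
    (hΨ : ∀ t ∈ Icc 0 δ, HasDerivWithinAt Ψ
      (-(Ψ t).comp (fderiv ℝ (fun x => A x (g x)) (y t))) (Icc 0 δ) t)
    (hΨ1 : ∀ t ∈ Icc 0 δ, ‖Ψ t - ContinuousLinearMap.id ℝ E‖ ≤ 1 / 2) :
    ∃ C, ∀ i, ‖u i (τ i) - y (τ i)‖ ≤ C * τ i ^ (2 * s + 1) := by
  have hsub : ∀ i, Icc 0 (τ i) ⊆ Icc 0 δ := fun i => Icc_subset_Icc_right (hτδ i)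
  have hτ0 : ∀ i, 0 ≤ τ i := fun i => (hτ i).le
  set f : E → E := fun x => A x (g x) with hfdef
  have hf : ContDiffOn ℝ (2 * s : ℕ) f U := hA.clm_apply hg
  have hs2 : (s : WithTop ℕ∞) ≤ (2 * s : ℕ) := by exact_mod_cast (by omega : s ≤ 2 * s)
  have h2s : (2 : WithTop ℕ∞) ≤ (2 * s : ℕ) := by exact_mod_cast (by omega : 2 ≤ 2 * s)
  obtain ⟨n, hn⟩ : ∃ n, 2 * s = n + 1 := ⟨2 * s - 1, by omega⟩
  -- Regularity of all the curves involved.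
  have huN := unifDiff_path hsk hτ hτ1 hU hD hDU (hA.of_le hs2) (hg.of_le hs2) huD hu
  have hyN := unifDiff_solution (τ := τ) hU hD hDU hf hτδ hyD hy
  have hyD' : ∀ i, ∀ t ∈ Icc 0 (τ i), y t ∈ D := fun i t ht => hyD t (hsub i ht)
  have hΛ : UnifDiff τ n fun _ t => fderiv ℝ f (y t) := by
    refine UnifDiff.comp hU hD hDU (hf.fderiv_of_isOpen hU ?_) (hyN.mono (by omega)) hyD'
    rw [hn]
    norm_cast
  have hΨN : UnifDiff τ (2 * s) fun _ => Ψ := hn ▸ unifDiff_adjoint hτδ hΨ hΛ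
  -- The residual is bounded by `h ^ s`, hence the error by `h ^ (s + 1)`.
  obtain ⟨C₁, hC₁, hr⟩ := norm_resid_le hsk hτ hτ1 hU hD hDU (hA.of_le hs2) (hg.of_le hs2) huD
    (huN s)
  have hud : ∀ i, ∀ t ∈ Icc 0 (τ i), HasDerivWithinAt (u i)
      (resid k s A g (τ i) (u i) t + f (u i t)) (Icc 0 (τ i)) t := by
    intro i t _
    rw [resid, sub_add_cancel]
    exact (hasDerivAt_of_path (hτ i) (hu i) t).hasDerivWithinAt
  have hyd : ∀ i, ∀ t ∈ Icc 0 (τ i), HasDerivWithinAt y (f (y t)) (Icc 0 (τ i)) t :=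
    fun i t ht => (hy t (hsub i ht)).mono (hsub i)
  have he0 : ∀ i, u i 0 - y 0 = 0 := by
    intro i
    have := hu i 0
    rw [zero_mul, incr_zero, smul_zero, add_zero] at this
    rw [this, sub_self]
  have he : ∀ i, ∀ t ∈ Icc 0 (τ i), ‖u i t - y t‖ ≤ 2 * τ i * (C₁ * τ i ^ s) := by
    intro i
    refine norm_error_le (hτ0 i) (hLτ i) (fun t ht => (hud i t ht).sub (hyd i t ht)) (he0 i)
      (fun t ht => ?_) hL0
    rw [add_sub_assoc, add_comm]
    exact (norm_add_le _ _).trans (add_le_add (hL _ (huD i t ht) _ (hyD' i t ht)) (hr i t ht))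
  -- The derivative of `Ψ e`.
  have hd : ∀ i, ∀ t ∈ Icc 0 (τ i), HasDerivWithinAt (fun t => Ψ t (u i t - y t))
      (Ψ t (resid k s A g (τ i) (u i) t) +
        Ψ t (f (u i t) - f (y t) - fderiv ℝ f (y t) (u i t - y t))) (Icc 0 (τ i)) t := by
    intro i t ht
    refine (((hΨ t (hsub i ht)).mono (hsub i)).clm_apply
      ((hud i t ht).sub (hyd i t ht))).congr_deriv ?_
    simp only [Pi.sub_apply, neg_apply, ContinuousLinearMap.comp_apply, map_sub, map_add]
    abel
  obtain ⟨L', hL'0, hL'⟩ := exists_linearization_bound hU hD hDc hDU (hf.of_le h2s)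
  obtain ⟨M, hM0, hM⟩ := hΨN.bound
  have hη : ∀ i, ∀ t ∈ Icc 0 (τ i), ‖Ψ t (resid k s A g (τ i) (u i) t) +
      Ψ t (f (u i t) - f (y t) - fderiv ℝ f (y t) (u i t - y t)) -
      Ψ t (resid k s A g (τ i) (u i) t)‖ ≤ M * (L' * (2 * C₁) ^ 2) * τ i ^ (2 * s) := by
    intro i t ht
    rw [add_sub_cancel_left]
    refine (ContinuousLinearMap.le_opNorm _ _).trans ?_
    rw [mul_assoc]
    refine mul_le_mul (hM i t ht) ((hL' _ (huD i t ht) _ (hyD' i t ht)).trans ?_)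
      (norm_nonneg _) hM0
    rw [mul_assoc]
    refine mul_le_mul_of_nonneg_left ?_ hL'0
    calc ‖u i t - y t‖ ^ 2 ≤ (2 * τ i * (C₁ * τ i ^ s)) ^ 2 :=
          pow_le_pow_left₀ (norm_nonneg _) (he i t ht) 2
      _ = (2 * C₁) ^ 2 * τ i ^ (2 * s) * τ i ^ 2 := by ring
      _ ≤ (2 * C₁) ^ 2 * τ i ^ (2 * s) * 1 :=
          mul_le_mul_of_nonneg_left (pow_le_one₀ (hτ0 i) (hτ1 i))
            (mul_nonneg (sq_nonneg _) (pow_nonneg (hτ0 i) _))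
      _ = _ := mul_one _
  have hrN : UnifDiff τ (2 * s) fun i t => resid k s A g (τ i) (u i) t := by
    have hA' := UnifDiff.comp hU hD hDU hA (huN (2 * s)) huD
    have hg' := UnifDiff.comp hU hD hDU hg (huN (2 * s)) huD
    have h1 := (UnifDiff.field hsk hτ hτ1 hU hD hDU le_rfl (hA.of_le hs2) (hg.of_le hs2) huD
      (huN s)).proj (N := 2 * s) hsk hτ hτ1 le_rfl (Or.inr le_rfl)
    refine (h1.sub (hA'.apply hg')).congr fun i t _ => ?_
    simp only [mul_div_cancel_right₀ _ (hτ i).ne']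
    rfl
  obtain ⟨C₂, hC₂⟩ := (hΨN.apply hrN).norm_sub_quad_le (k := k) (by omega) hτ0 hη hd
  obtain ⟨C₃, -, hC₃⟩ := norm_quad_resid_le hsk hτ hτ1 hU hD hDU (hA.of_le hs2) (hg.of_le hs2) huD
    (huN s) (hΨN.mono (by omega : s ≤ 2 * s))
  refine ⟨2 * (C₂ + C₃), fun i => ?_⟩
  have h1 := hC₂ i
  rw [he0 i, map_zero, sub_zero] at h1
  have h2 : ‖τ i • quad k (fun c => Ψ (c * τ i) (resid k s A g (τ i) (u i) (c * τ i)))‖ ≤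
      C₃ * τ i ^ (2 * s + 1) := by
    rw [norm_smul, Real.norm_of_nonneg (hτ0 i), pow_succ, ← mul_assoc, mul_comm]
    exact mul_le_mul_of_nonneg_right (hC₃ i) (hτ0 i)
  have h3 : ‖Ψ (τ i) (u i (τ i) - y (τ i))‖ ≤ (C₂ + C₃) * τ i ^ (2 * s + 1) := by
    rw [add_mul]
    exact (norm_le_norm_sub_add _ _).trans (add_le_add h1 h2)
  have h4 : ‖u i (τ i) - y (τ i)‖ ≤ ‖Ψ (τ i) (u i (τ i) - y (τ i))‖ +
      1 / 2 * ‖u i (τ i) - y (τ i)‖ := by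
    have h5 : u i (τ i) - y (τ i) = Ψ (τ i) (u i (τ i) - y (τ i)) -
        (Ψ (τ i) - ContinuousLinearMap.id ℝ E) (u i (τ i) - y (τ i)) := by simp
    conv_lhs => rw [h5]
    refine (norm_sub_le _ _).trans (add_le_add_right ?_ _)
    refine (ContinuousLinearMap.le_opNorm _ _).trans ?_
    exact mul_le_mul_of_nonneg_right (hΨ1 _ ⟨hτ0 i, hτδ i⟩) (norm_nonneg _)
  linarith

end Convergence

/-! ### Existence and uniqueness of the numerical solution -/

/-- A vector of stages, as a function on the line: the value at a node is the stage that belongs to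
it, and the values elsewhere are irrelevant. -/
noncomputable def extend {E : Type*} [Zero E] (k : ℕ) (v : nodes k → E) (c : ℝ) : E :=
  open Classical in if h : c ∈ nodes k then v ⟨c, h⟩ else 0

lemma extend_of_mem {E : Type*} [Zero E] {k : ℕ} {v : nodes k → E} {c : ℝ} (hc : c ∈ nodes k) :
    extend k v c = v ⟨c, hc⟩ := by
  simp [extend, hc]

section Existence

universe u

variable {E : Type u} [NormedAddCommGroup E] [NormedSpace ℝ E] {k s : ℕ} {A : E → E →L[ℝ] E}
  {g : E → E} {U K : Set E} {y₀ : E}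

lemma field_congr {φ ψ : ℝ → E} (h : ∀ c ∈ nodes k, φ c = ψ c) :
    ∀ c ∈ nodes k, field k s A g φ c = field k s A g ψ c := by
  intro c hc
  rw [field, field, h c hc, proj_congr fun x hx => by rw [h x hx]]

lemma incr_congr {φ ψ : ℝ → E} (h : ∀ c ∈ nodes k, φ c = ψ c) :
    incr k s A g φ = incr k s A g ψ := by
  funext c
  exact Finset.sum_congr rfl fun i _ => by rw [coef_congr (field_congr h)]

/-- The increment is bounded as long as the stages stay in a compact set. -/
lemma exists_norm_incr_le (hK : IsCompact K) (hA : ContinuousOn A K) (hg : ContinuousOn g K) :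
    ∃ M, 0 ≤ M ∧ ∀ φ : ℝ → E, (∀ c ∈ nodes k, φ c ∈ K) → ∀ x ∈ Icc (0 : ℝ) 1,
      ‖incr k s A g φ x‖ ≤ M := by
  obtain ⟨a, ha⟩ := hK.exists_bound_of_continuousOn hA
  obtain ⟨b, hb⟩ := hK.exists_bound_of_continuousOn hg
  obtain ⟨D, hD0, hD⟩ := exists_norm_proj_le (E := E) k s
  choose B hB0 hB using fun i => exists_norm_coef_le (E := E) k i
  have hI : ∀ i, ContinuousOn (fun c => ∫ x in (0 : ℝ)..c, (P i).eval x) (Icc 0 1) := fun i =>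
    (intervalIntegral.continuous_primitive (fun a b => intervalIntegrable_eval (P i) a b)
      0).continuousOn
  choose I hI using fun i => isCompact_Icc.exists_bound_of_continuousOn (hI i)
  have hI0 : ∀ i, 0 ≤ I i := fun i => (norm_nonneg _).trans (hI i 0 (by simp))
  refine ⟨∑ i ∈ Finset.range s, I i * (B i * (|a| * (D * |b|))), Finset.sum_nonneg fun i _ =>
    mul_nonneg (hI0 i) (mul_nonneg (hB0 i) (by positivity)), fun φ hφ x hx => ?_⟩
  refine (norm_sum_le _ _).trans (Finset.sum_le_sum fun i _ => ?_)
  rw [norm_smul]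
  refine mul_le_mul (hI i x hx) (hB i _ _ (by positivity) fun c hc => ?_) (norm_nonneg _) (hI0 i)
  refine (ContinuousLinearMap.le_opNorm _ _).trans ?_
  exact mul_le_mul ((ha _ (hφ c hc)).trans (le_abs_self a))
    (hD _ _ (abs_nonneg b) (fun x hx => (hb _ (hφ x hx)).trans (le_abs_self b)) c
      (mem_Icc_of_mem_nodes hc)) (norm_nonneg _) (abs_nonneg a)

lemma contDiffAt_comp_extend {F : Type u} [NormedAddCommGroup F] [NormedSpace ℝ F] {f : E → F}
    (hf : ContDiffAt ℝ 1 f y₀) {c : ℝ} (hc : c ∈ nodes k) :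
    ContDiffAt ℝ 1 (fun v : nodes k → E => f (extend k v c)) fun _ => y₀ := by
  simp only [extend_of_mem hc]
  exact ContDiffAt.comp (fun _ : nodes k => y₀) hf (contDiff_apply ℝ E _).contDiffAt

lemma contDiffAt_incr (hA : ContDiffAt ℝ 1 A y₀) (hg : ContDiffAt ℝ 1 g y₀) (x : ℝ) :
    ContDiffAt ℝ 1 (fun v : nodes k → E => incr k s A g (extend k v) x) fun _ => y₀ := by
  unfold incr coef quad field proj coef quad
  refine ContDiffAt.sum fun i _ => ContDiffAt.const_smul _ <| ContDiffAt.sum fun c hc =>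
    ContDiffAt.const_smul _ <| ContDiffAt.const_smul _ <|
      (contDiffAt_comp_extend hA hc).clm_apply <| ContDiffAt.sum fun j _ =>
      ContDiffAt.const_smul _ <| ContDiffAt.sum fun c' hc' =>
      ContDiffAt.const_smul _ <| ContDiffAt.const_smul _ <| contDiffAt_comp_extend hg hc'

lemma norm_sub_le_of_path {M : ℝ} (hM : ∀ φ : ℝ → E, (∀ c ∈ nodes k, φ c ∈ K) →
      ∀ x ∈ Icc (0 : ℝ) 1, ‖incr k s A g φ x‖ ≤ M) {h : ℝ} (hh : 0 < h) {w : ℝ → E}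
    (hw : ∀ c, w (c * h) = y₀ + h • incr k s A g (fun x => w (x * h)) c)
    (hwK : ∀ c ∈ nodes k, w (c * h) ∈ K) {t : ℝ} (ht : t ∈ Icc 0 h) : ‖w t - y₀‖ ≤ h * M := by
  have h1 := hw (t / h)
  rw [div_mul_cancel₀ _ hh.ne'] at h1
  rw [h1, add_sub_cancel_left, norm_smul, Real.norm_of_nonneg hh.le]
  exact mul_le_mul_of_nonneg_left (hM _ hwK _
    ⟨div_nonneg ht.1 hh.le, div_le_one_of_le₀ ht.2 hh.le⟩) hh.le

/-- For small step sizes the equation for the stages is a contraction near the initial value, and a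
priori all solutions with stages in `K` are near the initial value. -/
lemma exists_unique_path [CompleteSpace E] (hK : IsCompact K) (hy₀ : K ∈ nhds y₀)
    (hA : ContinuousOn A K) (hg : ContinuousOn g K) (hA' : ContDiffAt ℝ 1 A y₀)
    (hg' : ContDiffAt ℝ 1 g y₀) :
    ∃ δ, 0 < δ ∧ ∀ h, 0 < h → h ≤ δ → ∃! w : ℝ → E,
      (∀ c, w (c * h) = y₀ + h • incr k s A g (fun x => w (x * h)) c) ∧
        ∀ c ∈ nodes k, w (c * h) ∈ K := by
  obtain ⟨M, hM0, hM⟩ := exists_norm_incr_le (k := k) (s := s) hK hA hg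
  set v₀ : nodes k → E := fun _ => y₀ with hv₀
  set V : (nodes k → E) → nodes k → E := fun v c => incr k s A g (extend k v) c with hV
  have hVd : ContDiffAt ℝ 1 V v₀ := contDiffAt_pi.2 fun c => contDiffAt_incr hA' hg' c
  obtain ⟨L, N, hN, hLN⟩ := hVd.exists_lipschitzOnWith
  obtain ⟨ρ₁, hρ₁, hρN⟩ := Metric.nhds_basis_closedBall.mem_iff.1 hN
  obtain ⟨ρ₂, hρ₂, hρK⟩ := Metric.nhds_basis_closedBall.mem_iff.1 hy₀
  set ρ := min ρ₁ ρ₂ with hρdef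
  have hρ : 0 < ρ := lt_min hρ₁ hρ₂
  have hLρ : LipschitzOnWith L V (Metric.closedBall v₀ ρ) :=
    hLN.mono ((Metric.closedBall_subset_closedBall (min_le_left _ _)).trans hρN)
  have hballK : ∀ v ∈ Metric.closedBall v₀ ρ, ∀ c ∈ nodes k, extend k v c ∈ K := by
    intro v hv c hc
    rw [extend_of_mem hc]
    refine hρK (Metric.mem_closedBall.2 ?_)
    exact (dist_le_pi_dist v v₀ ⟨c, hc⟩).trans
      ((Metric.mem_closedBall.1 hv).trans (min_le_right _ _))
  set δ := min (ρ / (M + 1)) (1 / (2 * (L + 1) : ℝ)) with hδ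
  have hL0 : (0 : ℝ) ≤ L := L.2
  refine ⟨δ, lt_min (by positivity) (by positivity), fun h hh hhδ => ?_⟩
  have hhM : h * M ≤ ρ := by
    have h1 : h * (M + 1) ≤ ρ := (le_div_iff₀ (by positivity)).1 (hhδ.trans (min_le_left _ _))
    nlinarith
  have hhL : h * L ≤ 1 / 2 := by
    have h1 : h * (2 * (L + 1)) ≤ 1 :=
      (le_div_iff₀ (by positivity)).1 (hhδ.trans (min_le_right _ _))
    nlinarith
  set Φ : (nodes k → E) → nodes k → E := fun v => v₀ + h • V v with hΦ
  have hΦL : ∀ v ∈ Metric.closedBall v₀ ρ, ∀ w ∈ Metric.closedBall v₀ ρ,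
      dist (Φ v) (Φ w) ≤ 1 / 2 * dist v w := by
    intro v hv w hw
    rw [hΦ, dist_add_left, dist_smul₀, Real.norm_of_nonneg hh.le]
    calc h * dist (V v) (V w) ≤ h * (L * dist v w) :=
          mul_le_mul_of_nonneg_left (hLρ.dist_le_mul v hv w hw) hh.le
      _ ≤ 1 / 2 * dist v w := by
          rw [← mul_assoc]
          exact mul_le_mul_of_nonneg_right hhL dist_nonneg
  have hmaps : MapsTo Φ (Metric.closedBall v₀ ρ) (Metric.closedBall v₀ ρ) := by
    intro v hv
    rw [mem_closedBall_iff_norm, hΦ, add_sub_cancel_left, norm_smul, Real.norm_of_nonneg hh.le]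
    refine (mul_le_mul_of_nonneg_left ?_ hh.le).trans hhM
    exact (pi_norm_le_iff_of_nonneg hM0).2 fun c =>
      hM _ (hballK v hv) c (mem_Icc_of_mem_nodes c.2)
  have hcontr : ContractingWith (1 / 2) (hmaps.restrict Φ _ _) := by
    refine ⟨by rw [← NNReal.coe_lt_coe]; norm_num, LipschitzWith.of_dist_le_mul fun v w => ?_⟩
    rw [NNReal.coe_div, NNReal.coe_one, NNReal.coe_ofNat]
    exact hΦL v v.2 w w.2
  obtain ⟨v, hv, hfix, -⟩ := hcontr.exists_fixedPoint' Metric.isClosed_closedBall.isComplete hmaps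
    (Metric.mem_closedBall_self hρ.le) (edist_ne_top _ _)
  -- The path with stages `v`.
  set w : ℝ → E := fun t => y₀ + h • incr k s A g (extend k v) (t / h) with hw
  have hwc : ∀ c, w (c * h) = y₀ + h • incr k s A g (extend k v) c := fun c => by
    rw [hw]
    simp only [mul_div_cancel_right₀ _ hh.ne']
  have hwv : ∀ c ∈ nodes k, extend k v c = w (c * h) := by
    intro c hc
    rw [extend_of_mem hc, hwc]
    exact (congrFun hfix ⟨c, hc⟩).symm
  refine ⟨w, ⟨fun c => ?_, fun c hc => hwv c hc ▸ hballK v hv c hc⟩, ?_⟩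
  · rw [hwc, incr_congr hwv]
  · rintro w' ⟨hw', hwK'⟩
    set v' : nodes k → E := fun c => w' (c * h) with hv'def
    have hv'e : ∀ c ∈ nodes k, extend k v' c = w' (c * h) := fun c hc => extend_of_mem hc
    have hv' : v' ∈ Metric.closedBall v₀ ρ := by
      rw [mem_closedBall_iff_norm]
      refine (pi_norm_le_iff_of_nonneg hρ.le).2 fun c => ?_
      exact (norm_sub_le_of_path hM hh hw' hwK'
        (mul_mem_Icc hh.le (mem_Icc_of_mem_nodes c.2))).trans hhM
    have hfix' : Φ v' = v' := by
      funext c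
      change y₀ + h • incr k s A g (extend k v') c = w' (c * h)
      rw [hw', incr_congr hv'e]
    have hvv : v' = v := by
      have h1 := hΦL v' hv' v hv
      rw [hfix', hfix] at h1
      exact dist_le_zero.1 (by linarith)
    funext t
    have h1 := hw' (t / h)
    rw [div_mul_cancel₀ _ hh.ne', ← incr_congr hv'e, hvv] at h1
    exact h1

end Existence

/-! ### Matrices and gradients -/

section Euclidean

variable {m : ℕ} {k s : ℕ}

/-- The matrix valued function `B`, as a function with values in the continuous linear maps. -/
noncomputable def matCLM (B : EuclideanSpace ℝ (Fin m) → Matrix (Fin m) (Fin m) ℝ)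
    (x : EuclideanSpace ℝ (Fin m)) : EuclideanSpace ℝ (Fin m) →L[ℝ] EuclideanSpace ℝ (Fin m) :=
  Matrix.toEuclideanCLM (𝕜 := ℝ) (B x)

lemma act_eq (M : Matrix (Fin m) (Fin m) ℝ) (v : EuclideanSpace ℝ (Fin m)) :
    act M v = Matrix.toEuclideanCLM (𝕜 := ℝ) M v := rfl

lemma contDiffOn_matCLM {n : WithTop ℕ∞} {U : Set (EuclideanSpace ℝ (Fin m))}
    {B : EuclideanSpace ℝ (Fin m) → Matrix (Fin m) (Fin m) ℝ}
    (hB : ∀ a b : Fin m, ContDiffOn ℝ n (fun x => B x a b) U) : ContDiffOn ℝ n (matCLM B) U := by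
  have h : matCLM B = fun x => ∑ a, ∑ b, B x a b •
      (Matrix.toEuclideanCLM (𝕜 := ℝ) (Matrix.single a b (1 : ℝ)) :
        EuclideanSpace ℝ (Fin m) →L[ℝ] EuclideanSpace ℝ (Fin m)) := by
    funext x
    rw [matCLM]
    conv_lhs => rw [Matrix.matrix_eq_sum_single (B x)]
    simp only [map_sum, ← map_smul, Matrix.smul_single, smul_eq_mul, mul_one]
  rw [h]
  exact ContDiffOn.sum fun a _ => ContDiffOn.sum fun b _ => (hB a b).smul contDiffOn_const

lemma contDiffOn_gradient {n : ℕ} {U : Set (EuclideanSpace ℝ (Fin m))} (hU : IsOpen U)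
    {H : EuclideanSpace ℝ (Fin m) → ℝ} (hH : ContDiffOn ℝ (n + 1 : ℕ) H U) :
    ContDiffOn ℝ n (gradient H) U := by
  have hd : ContDiffOn ℝ n (fderiv ℝ H) U := hH.fderiv_of_isOpen hU (by norm_cast)
  let L : (EuclideanSpace ℝ (Fin m) →L[ℝ] ℝ) →ₗ[ℝ] EuclideanSpace ℝ (Fin m) :=
    { toFun := (InnerProductSpace.toDual ℝ (EuclideanSpace ℝ (Fin m))).symm
      map_add' := map_add _
      map_smul' := fun c x => by simp }
  exact (LinearMap.toContinuousLinearMap L).contDiff.comp_contDiffOn hd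

lemma isPath_iff {B : EuclideanSpace ℝ (Fin m) → Matrix (Fin m) (Fin m) ℝ}
    {H : EuclideanSpace ℝ (Fin m) → ℝ} {y₀ : EuclideanSpace ℝ (Fin m)} {h : ℝ}
    {u : ℝ → EuclideanSpace ℝ (Fin m)} :
    IsPath k s B H y₀ h u ↔
      ∀ c, u (c * h) = y₀ + h • incr k s (matCLM B) (gradient H) (fun x => u (x * h)) c := by
  have hg : ∀ j, gammaHat k H h u j = coef k j fun x => gradient H (u (x * h)) := by
    intro j
    simp only [gammaHat, coef, quad, smul_smul]
  have key : ∀ i, coef k i (field k s (matCLM B) (gradient H) fun x => u (x * h)) =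
      ∑ j ∈ Finset.range s, act (rhoHat k B h u i j) (gammaHat k H h u j) := by
    intro i
    simp only [act_eq, rhoHat, map_sum, map_smul, sum_apply, smul_apply]
    rw [Finset.sum_comm, coef, quad]
    refine Finset.sum_congr rfl fun c _ => ?_
    simp only [field, proj, map_sum, map_smul, Finset.smul_sum, smul_smul, hg, mul_assoc]
    rfl
  have hsum : ∀ c, incr k s (matCLM B) (gradient H) (fun x => u (x * h)) c =
      ∑ i ∈ Finset.range s, ∑ j ∈ Finset.range s, (∫ x in (0 : ℝ)..c, (P i).eval x) •
        act (rhoHat k B h u i j) (gammaHat k H h u j) := by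
    intro c
    simp only [incr, key, Finset.smul_sum]
  simp only [IsPath, hsum]

end Euclidean

end PHBVM

theorem mainTheorem3 {m : ℕ} (k s : ℕ) (hs : 1 ≤ s) (hsk : s ≤ k)
    (U : Set (EuclideanSpace ℝ (Fin m))) (hU : IsOpen U)
    (H : EuclideanSpace ℝ (Fin m) → ℝ)
    (hH : ContDiffOn ℝ ((2 * s + 1 : ℕ) : WithTop ℕ∞) H U)
    (B : EuclideanSpace ℝ (Fin m) → Matrix (Fin m) (Fin m) ℝ)
    (hB : ∀ a b : Fin m, ContDiffOn ℝ ((2 * s : ℕ) : WithTop ℕ∞) (fun x => B x a b) U)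
    (hskew : ∀ x ∈ U, (B x).transpose = -(B x))
    (y₀ : EuclideanSpace ℝ (Fin m))
    (T : ℝ) (hT : 0 < T) (y : ℝ → EuclideanSpace ℝ (Fin m)) (hy₀ : y 0 = y₀)
    (hyU : ∀ t ∈ Set.Icc 0 T, y t ∈ U)
    (hy : ∀ t ∈ Set.Icc 0 T,
      HasDerivWithinAt y (PHBVM.act (B (y t)) (gradient H (y t))) (Set.Icc 0 T) t)
    (K : Set (EuclideanSpace ℝ (Fin m))) (hK : IsCompact K) (hKU : K ⊆ U) (hy₀K : K ∈ nhds y₀) :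
    ∃ C h₀ : ℝ, 0 < h₀ ∧ h₀ ≤ T ∧ ∀ h : ℝ, 0 < h → h ≤ h₀ →
      (∃! u : ℝ → EuclideanSpace ℝ (Fin m),
        PHBVM.IsPath k s B H y₀ h u ∧ ∀ c ∈ PHBVM.nodes k, u (c * h) ∈ K) ∧
      ∀ u : ℝ → EuclideanSpace ℝ (Fin m),
        PHBVM.IsPath k s B H y₀ h u → (∀ c ∈ PHBVM.nodes k, u (c * h) ∈ K) →
          ‖u h - y h‖ ≤ C * h ^ (2 * s + 1) := by
  set A := PHBVM.matCLM B with hAdef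
  set g := gradient H with hgdef
  have hA : ContDiffOn ℝ (2 * s : ℕ) A U := PHBVM.contDiffOn_matCLM hB
  have hg : ContDiffOn ℝ (2 * s : ℕ) g U := PHBVM.contDiffOn_gradient hU hH
  have hf : ContDiffOn ℝ (2 * s : ℕ) (fun x => A x (g x)) U := hA.clm_apply hg
  have h1s : (1 : WithTop ℕ∞) ≤ (2 * s : ℕ) := by exact_mod_cast (by omega : 1 ≤ 2 * s)
  have hyU₀ : U ∈ nhds y₀ := hU.mem_nhds (hKU (mem_of_mem_nhds hy₀K))
  simp only [PHBVM.isPath_iff]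
  obtain ⟨δ₁, hδ₁, hex⟩ := PHBVM.exists_unique_path (k := k) (s := s) hK hy₀K
    (hA.continuousOn.mono hKU) (hg.continuousOn.mono hKU) ((hA.of_le h1s).contDiffAt hyU₀)
    ((hg.of_le h1s).contDiffAt hyU₀)
  obtain ⟨M, hM0, hM⟩ := PHBVM.exists_norm_incr_le (k := k) (s := s) hK
    (hA.continuousOn.mono hKU) (hg.continuousOn.mono hKU)
  -- A ball in `K` that contains the exact and the numerical solution for small times.
  obtain ⟨ρ, hρ, hρK⟩ := Metric.nhds_basis_closedBall.mem_iff.1 hy₀K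
  have hD : IsCompact (Metric.closedBall y₀ ρ) := isCompact_closedBall _ _
  have hDc : Convex ℝ (Metric.closedBall y₀ ρ) := convex_closedBall _ _
  have hDU := hρK.trans hKU
  have hyc : ContinuousOn y (Set.Icc 0 T) := fun t ht => (hy t ht).continuousWithinAt
  obtain ⟨ε, hε, hyε⟩ := Metric.continuousWithinAt_iff.1 (hyc 0 ⟨le_rfl, hT.le⟩) ρ hρ
  obtain ⟨L, hL0, hL⟩ := PHBVM.exists_lipschitz_bound hU hD hDc hDU (hf.of_le h1s)
  have hΛ : ContinuousOn (fun t => fderiv ℝ (fun x => A x (g x)) (y t)) (Set.Icc 0 T) :=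
    ((hf.of_le h1s).fderiv_of_isOpen (m := 0) hU (by simp)).continuousOn.comp hyc hyU
  obtain ⟨δ₂, hδ₂, hδ₂T, Ψ, hΨ, hΨ1⟩ := PHBVM.exists_adjoint_solution hT hΛ
  set h₀ := min (min δ₁ δ₂) (min (min 1 (ε / 2)) (min (ρ / (M + 1)) (1 / (2 * (L + 1))))) with hh₀
  have hh₀0 : 0 < h₀ := by positivity
  have hle₁ : h₀ ≤ δ₁ := (min_le_left _ _).trans (min_le_left _ _)
  have hle₂ : h₀ ≤ δ₂ := (min_le_left _ _).trans (min_le_right _ _)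
  have hle₃ : h₀ ≤ 1 := (min_le_right _ _).trans ((min_le_left _ _).trans (min_le_left _ _))
  have hle₄ : h₀ ≤ ε / 2 := (min_le_right _ _).trans ((min_le_left _ _).trans (min_le_right _ _))
  have hle₅ : h₀ * (M + 1) ≤ ρ := (le_div_iff₀ (by positivity)).1
    ((min_le_right _ _).trans ((min_le_right _ _).trans (min_le_left _ _)))
  have hle₆ : h₀ * (2 * (L + 1)) ≤ 1 := (le_div_iff₀ (by positivity)).1
    ((min_le_right _ _).trans ((min_le_right _ _).trans (min_le_right _ _)))
  have hsubT : Set.Icc 0 h₀ ⊆ Set.Icc 0 T := Set.Icc_subset_Icc_right (hle₂.trans hδ₂T)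
  have hsub₂ : Set.Icc 0 h₀ ⊆ Set.Icc 0 δ₂ := Set.Icc_subset_Icc_right hle₂
  -- The family of all numerical solutions with step size at most `h₀`.
  let ι := {p : ℝ × (ℝ → EuclideanSpace ℝ (Fin m)) // (0 < p.1 ∧ p.1 ≤ h₀) ∧
    (∀ c, p.2 (c * p.1) = y₀ + p.1 • PHBVM.incr k s A g (fun x => p.2 (x * p.1)) c) ∧
    ∀ c ∈ PHBVM.nodes k, p.2 (c * p.1) ∈ K}
  obtain ⟨C, hC⟩ := PHBVM.norm_sub_solution_le (ι := ι) (τ := fun i => i.1.1)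
    (u := fun i => i.1.2) (δ := h₀) hs hsk (fun i => i.2.1.1) (fun i => i.2.1.2.trans hle₃)
    (fun i => i.2.1.2) hU hD hDc hDU hA hg
    (fun i t ht => mem_closedBall_iff_norm.2 <|
      (PHBVM.norm_sub_le_of_path hM i.2.1.1 i.2.2.1 i.2.2.2 ht).trans (by
        nlinarith [mul_le_mul_of_nonneg_right i.2.1.2 hM0]))
    (fun i c => hy₀ ▸ i.2.2.1 c)
    (fun t ht => by
      have h1 := hyε (x := t) (hsubT ht) (by
        rw [Real.dist_eq, sub_zero, abs_of_nonneg ht.1]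
        linarith [ht.2])
      rw [hy₀] at h1
      exact Metric.mem_closedBall.2 h1.le)
    (fun t ht => (hy t (hsubT ht)).mono hsubT) hL0 hL
    (fun i => by nlinarith [mul_le_mul_of_nonneg_right i.2.1.2 hL0])
    (fun t ht => (hΨ t (hsub₂ ht)).mono hsub₂) (fun t ht => hΨ1 t (hsub₂ ht))
  exact ⟨C, h₀, hh₀0, hle₂.trans hδ₂T, fun h hh hhh₀ => ⟨hex h hh (hhh₀.trans hle₁),
    fun u hu huK => hC ⟨(h, u), ⟨hh, hhh₀⟩, hu, huK⟩⟩⟩
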